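/- **Conventions.** A *graph* $\Gamma$ has a vertex set $\mathrm V\Gamma$, an arc set $\mathrm A\Gamma$, maps $o,t:\mathrm A\Gamma\to\mathrm V\Gamma$ and $a\mapsto\bar a$ on $\mathrm A\Gamma$ with $\bar{\bar a}=a$, $o(a)=t(\bar a)$; self-reverse arcs ($\bar a=a$) are allowed. A tree is a connected graph without loops, parallel arcs or simple cycles of length at least $3$. A permutation group $(G,X)$ is a subgroup $G\le \mathrm{Sym}(X)$ with $X\neq\emptyset$. An *embedding* $(H,Y)\hookrightarrow(G,X)$ is an injection $\Phi:Y\to X$ such that a permutation $h$ of $Y$ lies in $H$ if and only if there is $g\in G$ with $g\Phi=\Phi h$. $(G,X)$ is *closed* if $G$ is closed in $\mathrm{Sym}(X)$ in the permutation topology (pointwise convergence, $X$ discrete), and *subdegree finite* if every orbit of every point stabiliser $G_x$ on $X$ is finite. A *graph of group actions* $\mathcal G$ consists of a connected non-empty base graph $\Delta$; a permutation group $(G(v),X(v))$ for each vertex $v$; for each arc $a$ a permutation group $(H(a),Y(a))$, the same for $a$ and $\bar a$, and an embedding $\Phi_a:(H(a),Y(a))\hookrightarrow(G(t(a)),X(t(a)))$;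 and for each self-reverse arc $a$ a permutation $h_a$ of $Y(a)$ with $h_aH(a)h_a^{-1}=H(a)$ and $h_a^2\in H(a)$. An *$a$-adhesion map* is a map $\gamma\Phi_a$, a *twisted* one (for $a$ self-reverse) is a map $\gamma\Phi_ah_a$, and an *$a$-adhesion set* is a set $\gamma\Phi_a(Y(a))$, where $\gamma\in G(t(a))$. A *scaffolding* for $\mathcal G$ is a graph $\Sigma$ with an equivalence relation $\sim$ on $\mathrm V\Sigma$, extended to arcs by $a\sim a'$ iff $o(a)\sim o(a')$ and $t(a)\sim t(a')$ (the classes are called vertex and arc bundles), a graph morphism $\pi:T_\Sigma=\Sigma/{\sim}\to\Delta$ and a map $p:\mathrm V\Sigma\cup\mathrm A\Sigma\to\bigsqcup_vX(v)\sqcup\bigsqcup_aY(a)$ (with $Y(a)$ and $Y(\bar a)$ identified), such that: $T_\Sigma$ is a tree; no arc joins two vertices of the same vertex bundle; $p$ restricts to a bijection from each vertex bundle $\tau$ onto $X(\pi(\tau))$ and from each arc bundle $\alpha$ onto $Y(\pi(\alpha))$; $p(\bar c)=p(c)$ for all arcs $c$; for each $\alpha\in\mathrm AT_\Sigma$ the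 map $\Psi_\alpha:Y(\pi(\alpha))\to X(t(\pi(\alpha)))$ with $\Psi_\alpha(p(c))=p(t(c))$ for $c\in\alpha$ is a $\pi(\alpha)$-adhesion map if $\pi(\alpha)$ is not self-reverse, while if $\pi(\alpha)$ is self-reverse one of $\Psi_\alpha,\Psi_{\bar\alpha}$ is a $\pi(\alpha)$-adhesion map and the other a twisted one; and for all $\tau\in\mathrm VT_\Sigma$, all arcs $b$ of $\Delta$ with $t(b)=\pi(\tau)$ and all $b$-adhesion sets $D$ there is exactly one $\alpha\in\mathrm AT_\Sigma$ with $\pi(\alpha)=b$, $t(\alpha)=\tau$ and $\Psi_\alpha(Y(b))=D$. The *universal group* $\mathcal U(\mathcal G)$ is the group of all automorphisms $g$ of $\Sigma$ that leave $\sim$ and $\pi$ invariant and such that, for every $\tau\in\mathrm VT_\Sigma$, the permutation $g_\tau$ of $X(\pi(\tau))$ defined by $g_\tau(p(q))=p(g(q))$ for $q\in\tau$ lies in $G(\pi(\tau))$. It acts on the tree $T_\Sigma$. *Property (IP$_k$)*, $k\ge1$. Let a group act by automorphisms on a tree $T$ and let $G\le\mathrm{Aut}(T)$ be the group that it induces.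 For the vertex set $C=\{u,v\}$ of an edge of $T$ let $F_C$ be the subgroup of $G$ fixing pointwise all vertices at distance at most $k-1$ from $C$. For $x\in C$ let $T_{C,x}$ be the set of vertices whose closest vertex in $C$ is $x$, and let $F_{C,x}$ be the permutation group that $F_C$ induces on $T_{C,x}$. The action has Property (IP$_k$) if for every edge the restriction homomorphism $F_C\to F_{C,u}\times F_{C,v}$ is an isomorphism. **Theorem.** Let $\mathcal G$ be a graph of group actions whose base graph $\Delta$ is finite (finitely many vertices and arcs). Assume that $G(v)$ is closed and subdegree finite in its action on $X(v)$ for every $v\in\mathrm V\Delta$ and that $Y(a)$ is finite for every $a\in\mathrm A\Delta$. Then there is an integer $k\ge1$, depending only on $\mathcal G$, such that for every scaffolding $\Sigma$ of $\mathcal G$ the universal group $\mathcal U(\mathcal G)$ in its action on $T_\Sigma$ has Property (IP$_k$). -/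

import Mathlib

open Equiv

universe u v w x y z

theorem perm_apply_inv {α : Type u} (f : Perm α) (a : α) : f (f⁻¹ a) = a :=
  Equiv.apply_symm_apply f a

/-! ### Graphs -/

/-- A graph in the sense of Serre, except that self-reverse arcs (`rev a = a`) are allowed. -/
structure SerreGraph where
  /-- vertices -/
  V : Type u
  /-- arcs -/
  A : Type v
  /-- origin of an arc -/
  o : A → V
  /-- terminus of an arc -/
  t : A → V
  /-- reverse of an arc -/
  rev : A → A
  rev_rev : ∀ a, rev (rev a) = a
  t_rev : ∀ a, t (rev a) = o a

namespace SerreGraph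

theorem o_rev (Γ : SerreGraph.{u, v}) (a : Γ.A) : Γ.o (Γ.rev a) = Γ.t a := by
  rw [← Γ.t_rev, Γ.rev_rev]

/-- The underlying simple graph: distinct vertices are adjacent iff some arc joins them. -/
def toSimple (Γ : SerreGraph.{u, v}) : SimpleGraph Γ.V where
  Adj p q := p ≠ q ∧ ∃ a, Γ.o a = p ∧ Γ.t a = q
  symm := ⟨fun p q ⟨hne, a, ho, ht⟩ =>
    ⟨hne.symm, Γ.rev a, by rw [Γ.o_rev, ht], by rw [Γ.t_rev, ho]⟩⟩
  loopless := ⟨fun _ h => h.1 rfl⟩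

/-- Connected (and non-empty). -/
def IsConnected (Γ : SerreGraph.{u, v}) : Prop := Γ.toSimple.Connected

/-- A graph is simple if it has no loops and no parallel arcs. -/
def IsSimple (Γ : SerreGraph.{u, v}) : Prop :=
  (∀ a, Γ.o a ≠ Γ.t a) ∧ Function.Injective fun a => (Γ.o a, Γ.t a)

/-- A tree is a simple connected graph without simple cycles. -/
def IsTree (Γ : SerreGraph.{u, v}) : Prop := Γ.IsSimple ∧ Γ.toSimple.IsTree

/-- Two arcs belong to the same edge if they are equal or reverses of each other. -/
def edgeSetoid (Γ : SerreGraph.{u, v}) : Setoid Γ.A where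
  r a b := a = b ∨ a = Γ.rev b
  iseqv :=
    { refl := fun _ => Or.inl rfl
      symm := by
        rintro a b (h | h)
        · exact Or.inl h.symm
        · exact Or.inr (by rw [h, Γ.rev_rev])
      trans := by
        rintro a b c (rfl | rfl) (rfl | rfl)
        · exact Or.inl rfl
        · exact Or.inr rfl
        · exact Or.inr rfl
        · exact Or.inl (Γ.rev_rev _) }

/-- The set of edges `{a, rev a}`. -/
def Edge (Γ : SerreGraph.{u, v}) : Type v := Quotient Γ.edgeSetoid

/-- The edge `{a, rev a}`. -/
def edge (Γ : SerreGraph.{u, v}) (a : Γ.A) : Γ.Edge := Quotient.mk Γ.edgeSetoid a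

theorem edge_rev (Γ : SerreGraph.{u, v}) (a : Γ.A) : Γ.edge (Γ.rev a) = Γ.edge a :=
  Quotient.sound (s := Γ.edgeSetoid) (Or.inr rfl)

/-- Graph morphisms. -/
structure Hom (Γ : SerreGraph.{u, v}) (Γ' : SerreGraph.{w, x}) where
  onV : Γ.V → Γ'.V
  onA : Γ.A → Γ'.A
  map_o : ∀ a, onV (Γ.o a) = Γ'.o (onA a)
  map_t : ∀ a, onV (Γ.t a) = Γ'.t (onA a)
  map_rev : ∀ a, onA (Γ.rev a) = Γ'.rev (onA a)

/-- The automorphism group, as a group of pairs (permutation of vertices, permutation of arcs). -/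
def Aut (Γ : SerreGraph.{u, v}) : Subgroup (Perm Γ.V × Perm Γ.A) where
  carrier := {g | ∀ a, Γ.o (g.2 a) = g.1 (Γ.o a) ∧ Γ.t (g.2 a) = g.1 (Γ.t a) ∧
    Γ.rev (g.2 a) = g.2 (Γ.rev a)}
  one_mem' := fun _ => ⟨rfl, rfl, rfl⟩
  mul_mem' := by
    intro g h hg hh a
    have h1 := hg (h.2 a)
    have h2 := hh a
    refine ⟨?_, ?_, ?_⟩
    · simp [h1.1, h2.1]
    · simp [h1.2.1, h2.2.1]
    · simp [h1.2.2, h2.2.2]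
  inv_mem' := by
    intro g hg a
    have h1 := hg (g.2⁻¹ a)
    refine ⟨?_, ?_, ?_⟩
    · have := h1.1
      simp only [perm_apply_inv] at this
      simp [this]
    · have := h1.2.1
      simp only [perm_apply_inv] at this
      simp [this]
    · have := h1.2.2
      simp only [perm_apply_inv] at this
      simp [this]

/-- An equivalence relation on vertices extended to arcs: arcs are equivalent if their origins are
equivalent and their termini are equivalent. -/
def arcSetoid (Γ : SerreGraph.{u, v}) (s : Setoid Γ.V) : Setoid Γ.A where
  r a b := s (Γ.o a) (Γ.o b) ∧ s (Γ.t a) (Γ.t b)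
  iseqv :=
    { refl := fun _ => ⟨s.refl _, s.refl _⟩
      symm := fun h => ⟨s.symm h.1, s.symm h.2⟩
      trans := fun h h' => ⟨s.trans h.1 h'.1, s.trans h.2 h'.2⟩ }

/-- The quotient graph. -/
def quot (Γ : SerreGraph.{u, v}) (s : Setoid Γ.V) : SerreGraph.{u, v} where
  V := Quotient s
  A := Quotient (Γ.arcSetoid s)
  o := Quotient.map' (s₁ := Γ.arcSetoid s) (s₂ := s) Γ.o fun _ _ h => h.1
  t := Quotient.map' (s₁ := Γ.arcSetoid s) (s₂ := s) Γ.t fun _ _ h => h.2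
  rev := Quotient.map' (s₁ := Γ.arcSetoid s) (s₂ := Γ.arcSetoid s) Γ.rev fun a b h => by
    constructor
    · rw [Γ.o_rev, Γ.o_rev]; exact h.2
    · rw [Γ.t_rev, Γ.t_rev]; exact h.1
  rev_rev := by
    rintro ⟨a⟩
    exact congrArg (Quotient.mk (Γ.arcSetoid s)) (Γ.rev_rev a)
  t_rev := by
    rintro ⟨a⟩
    exact congrArg (Quotient.mk s) (Γ.t_rev a)

end SerreGraph

/-! ### Permutation groups -/

/-- The permutation topology on `Sym(X)`: pointwise convergence with `X` discrete, so that the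
pointwise stabilisers of finite sets form a neighbourhood basis of the identity. -/
abbrev permutationTopology (X : Type u) : TopologicalSpace (Perm X) :=
  TopologicalSpace.induced (fun g : Perm X => (g : X → X))
    (@Pi.topologicalSpace X (fun _ => X) fun _ => ⊥)

/-- `G` is closed in `Sym(X)` for the permutation topology. -/
def IsPermClosed {X : Type u} (G : Subgroup (Perm X)) : Prop :=
  @IsClosed (Perm X) (permutationTopology X) (G : Set (Perm X))

/-- All orbits of point stabilisers are finite. -/
def IsSubdegreeFinite {X : Type u} (G : Subgroup (Perm X)) : Prop :=
  ∀ p q : X, (MulAction.orbit (MulAction.stabilizer G p) q).Finite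

/-- `Φ` is an embedding of the permutation group `(H, Y)` into `(G, X)`: the permutations of `Y`
that correspond under `Φ` to elements of the group induced by the setwise stabiliser of `Φ(Y)` in
`G` are exactly the elements of `H`. -/
def IsActionEmbedding {Y : Type u} {X : Type v} (H : Subgroup (Perm Y)) (G : Subgroup (Perm X))
    (Φ : Y → X) : Prop :=
  Function.Injective Φ ∧ ∀ h : Perm Y, h ∈ H ↔ ∃ g ∈ G, ∀ y, g (Φ y) = Φ (h y)

/-! ### Graphs of group actions -/

/-- A graph of group actions. The action at an arc is the same as that at the reverse arc, so these
actions are indexed by the edges `{a, rev a}`. -/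
structure GraphOfGroupActions where
  /-- the base graph -/
  base : SerreGraph.{u, v}
  base_connected : base.IsConnected
  /-- the set on which the group at a vertex acts -/
  X : base.V → Type w
  X_nonempty : ∀ p, Nonempty (X p)
  /-- the permutation group at a vertex -/
  G : ∀ p, Subgroup (Perm (X p))
  /-- the set on which the group at an arc acts -/
  Y : base.Edge → Type x
  Y_nonempty : ∀ e, Nonempty (Y e)
  /-- the permutation group at an arc -/
  H : ∀ e, Subgroup (Perm (Y e))
  /-- the embedding of the action at an arc into the action at its terminus -/
  Φ : ∀ a : base.A, Y (base.edge a) → X (base.t a)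
  Φ_embedding : ∀ a, IsActionEmbedding (H (base.edge a)) (G (base.t a)) (Φ a)
  /-- the inversion agents of self-reverse arcs -/
  agent : ∀ a : base.A, base.rev a = a → Perm (Y (base.edge a))
  agent_conj : ∀ a ha h, h ∈ H (base.edge a) ↔ agent a ha * h * (agent a ha)⁻¹ ∈ H (base.edge a)
  agent_sq : ∀ a ha, agent a ha * agent a ha ∈ H (base.edge a)

namespace GraphOfGroupActions

variable (𝒢 : GraphOfGroupActions.{u, v, w, x})

/-- `Ψ` is an `a`-adhesion map: `Ψ = γ Φ_a` with `γ ∈ G(t(a))`. -/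
def IsAdhesionMap (a : 𝒢.base.A) (Ψ : 𝒢.Y (𝒢.base.edge a) → 𝒢.X (𝒢.base.t a)) : Prop :=
  ∃ γ ∈ 𝒢.G (𝒢.base.t a), ∀ y, Ψ y = γ (𝒢.Φ a y)

/-- `Ψ` is a twisted `a`-adhesion map: `a` is self-reverse and `Ψ = γ Φ_a h_a` with
`γ ∈ G(t(a))`. -/
def IsTwistedAdhesionMap (a : 𝒢.base.A) (Ψ : 𝒢.Y (𝒢.base.edge a) → 𝒢.X (𝒢.base.t a)) : Prop :=
  ∃ ha : 𝒢.base.rev a = a, ∃ γ ∈ 𝒢.G (𝒢.base.t a), ∀ y, Ψ y = γ (𝒢.Φ a (𝒢.agent a ha y))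

/-- `S` is an `a`-adhesion set: a `G(t(a))`-translate of the image of `Φ_a`. -/
def IsAdhesionSet (a : 𝒢.base.A) (S : Set (𝒢.X (𝒢.base.t a))) : Prop :=
  ∃ γ ∈ 𝒢.G (𝒢.base.t a), S = γ '' Set.range (𝒢.Φ a)

end GraphOfGroupActions

/-! ### Scaffoldings -/

/-- The data of a scaffolding: a graph, an equivalence relation on its vertices, a graph morphism
`π` from the quotient graph to the base graph, and a colouring `p` (given by `pV` on vertices and
`pA` on arcs). -/
structure ScaffoldingData (𝒢 : GraphOfGroupActions.{u, v, w, x}) where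
  graph : SerreGraph.{y, z}
  rel : Setoid graph.V
  π : (graph.quot rel).Hom 𝒢.base
  pV : graph.V → Σ p, 𝒢.X p
  pA : graph.A → Σ e, 𝒢.Y e

namespace ScaffoldingData

variable {𝒢 : GraphOfGroupActions.{u, v, w, x}} (S : ScaffoldingData.{u, v, w, x, y, z} 𝒢)

/-- The quotient graph `T`. -/
abbrev tree : SerreGraph.{y, z} := S.graph.quot S.rel

/-- The vertex of `T` given by a vertex of the scaffolding. -/
def bunV (q : S.graph.V) : S.tree.V := Quotient.mk S.rel q

/-- The arc of `T` given by an arc of the scaffolding. -/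
def bunA (c : S.graph.A) : S.tree.A := Quotient.mk (S.graph.arcSetoid S.rel) c

/-- `Ψ` is the map `Ψ_α` determined by the colouring at the arc `α` of `T`: one has
`Ψ(p(c)) = p(t(c))` for all arcs `c` in the bundle `α`. -/
def IsBundleMap (α : S.tree.A)
    (Ψ : 𝒢.Y (𝒢.base.edge (S.π.onA α)) → 𝒢.X (𝒢.base.t (S.π.onA α))) : Prop :=
  ∀ c, S.bunA c = α → ∀ y, S.pA c = ⟨𝒢.base.edge (S.π.onA α), y⟩ →
    S.pV (S.graph.t c) = ⟨𝒢.base.t (S.π.onA α), Ψ y⟩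

/-- The group of scaffolding automorphisms: graph automorphisms that leave `∼` and `π` invariant. -/
def scAut : Subgroup (Perm S.graph.V × Perm S.graph.A) where
  carrier := {g | g ∈ S.graph.Aut ∧ (∀ q r, S.rel q r ↔ S.rel (g.1 q) (g.1 r)) ∧
    (∀ q, S.π.onV (S.bunV (g.1 q)) = S.π.onV (S.bunV q)) ∧
    ∀ c, S.π.onA (S.bunA (g.2 c)) = S.π.onA (S.bunA c)}
  one_mem' := ⟨one_mem _, fun _ _ => Iff.rfl, fun _ => rfl, fun _ => rfl⟩
  mul_mem' := by
    rintro g h ⟨g1, g2, g3, g4⟩ ⟨h1, h2, h3, h4⟩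
    refine ⟨mul_mem g1 h1, fun q r => (h2 q r).trans (g2 _ _), fun q => ?_, fun c => ?_⟩
    · exact (g3 (h.1 q)).trans (h3 q)
    · exact (g4 (h.2 c)).trans (h4 c)
  inv_mem' := by
    rintro g ⟨g1, g2, g3, g4⟩
    refine ⟨inv_mem g1, fun q r => ?_, fun q => ?_, fun c => ?_⟩
    · have := g2 (g.1⁻¹ q) (g.1⁻¹ r)
      simp only [perm_apply_inv] at this
      exact this.symm
    · have := g3 (g.1⁻¹ q)
      simp only [perm_apply_inv] at this
      exact this.symm
    · have := g4 (g.2⁻¹ c)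
      simp only [perm_apply_inv] at this
      exact this.symm

/-- The permutation `σ` of `X(π(τ))` is the local action of `g` at the vertex `τ` of `T`:
`p(g(q)) = σ(p(q))` for all `q` in the bundle `τ`. -/
def IsLocalAction (g : Perm S.graph.V × Perm S.graph.A) (τ : S.tree.V)
    (σ : Perm (𝒢.X (S.π.onV τ))) : Prop :=
  ∀ q, S.bunV q = τ → ∀ ξ, S.pV q = ⟨S.π.onV τ, ξ⟩ → S.pV (g.1 q) = ⟨S.π.onV τ, σ ξ⟩

/-- `g` is acceptable: its local action at every vertex `τ` of `T` lies in `G(π(τ))`. -/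
def IsAcceptable (g : Perm S.graph.V × Perm S.graph.A) : Prop :=
  ∀ τ : S.tree.V, ∃ σ ∈ 𝒢.G (S.π.onV τ), S.IsLocalAction g τ σ

theorem isAcceptable_iff (g : Perm S.graph.V × Perm S.graph.A) :
    S.IsAcceptable g ↔ ∀ (τ : S.tree.V) (p : 𝒢.base.V), S.π.onV τ = p →
      ∃ σ ∈ 𝒢.G p, ∀ q, S.bunV q = τ → ∀ ξ, S.pV q = ⟨p, ξ⟩ → S.pV (g.1 q) = ⟨p, σ ξ⟩ := by
  constructor
  · rintro h τ p rfl
    exact h τ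
  · intro h τ
    exact h τ _ rfl

/-- A scaffolding automorphism acts on the vertices of `T`. -/
def treePerm (g : S.scAut) : Perm S.tree.V :=
  Quotient.congr (ra := S.rel) (rb := S.rel) g.1.1 g.2.2.1

theorem treePerm_bunV (g : S.scAut) (q : S.graph.V) :
    S.treePerm g (S.bunV q) = S.bunV (g.1.1 q) := rfl

theorem treePerm_adj (g : S.scAut) {σ τ : S.tree.V} (h : S.tree.toSimple.Adj σ τ) :
    S.tree.toSimple.Adj (S.treePerm g σ) (S.treePerm g τ) := by
  obtain ⟨hne, ⟨c⟩, ho, ht⟩ := h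
  refine ⟨(S.treePerm g).injective.ne hne, S.bunA (g.1.2 c), ?_, ?_⟩
  · rw [← ho]
    exact congrArg S.bunV (g.2.1 c).1
  · rw [← ht]
    exact congrArg S.bunV (g.2.1 c).2.1

theorem treePerm_mul (g h : S.scAut) : S.treePerm (g * h) = S.treePerm g * S.treePerm h := by
  ext ⟨q⟩
  rfl

theorem treePerm_one : S.treePerm 1 = 1 := by
  ext ⟨q⟩
  rfl

/-- The action of the group of scaffolding automorphisms on the tree `T`. -/
def treeHom : S.scAut →* (S.tree.toSimple ≃g S.tree.toSimple) where
  toFun g :=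
    { toEquiv := S.treePerm g
      map_rel_iff' := by
        intro σ τ
        refine ⟨fun h => ?_, S.treePerm_adj g⟩
        have h' := S.treePerm_adj g⁻¹ h
        have key : ∀ ρ, S.treePerm g⁻¹ (S.treePerm g ρ) = ρ := fun ρ => by
          rw [← Perm.mul_apply, ← treePerm_mul, inv_mul_cancel, treePerm_one, Perm.one_apply]
        rwa [key, key] at h' }
  map_one' := by
    ext ρ
    exact congrArg (fun f : Perm S.tree.V => f ρ) S.treePerm_one
  map_mul' g h := by
    ext ρ
    exact congrArg (fun f : Perm S.tree.V => f ρ) (S.treePerm_mul g h)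

end ScaffoldingData

/-- A scaffolding for a graph of group actions. -/
structure Scaffolding (𝒢 : GraphOfGroupActions.{u, v, w, x}) extends
    ScaffoldingData.{u, v, w, x, y, z} 𝒢 where
  isTree : toScaffoldingData.tree.IsTree
  /-- vertex bundles induce empty graphs -/
  bundle_empty : ∀ c, ¬ rel (graph.o c) (graph.t c)
  /-- `p` restricts to a bijection from each vertex bundle `τ` to `X(π(τ))` -/
  pV_bijOn : ∀ τ : toScaffoldingData.tree.V,
    Set.BijOn pV {q | toScaffoldingData.bunV q = τ}
      (Set.range (Sigma.mk (β := 𝒢.X) (π.onV τ)))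
  /-- `p` restricts to a bijection from each arc bundle `α` to `Y(π(α))` -/
  pA_bijOn : ∀ α : toScaffoldingData.tree.A,
    Set.BijOn pA {c | toScaffoldingData.bunA c = α}
      (Set.range (Sigma.mk (β := 𝒢.Y) (𝒢.base.edge (π.onA α))))
  pA_rev : ∀ c, pA (graph.rev c) = pA c
  adhesion_of_ne : ∀ α : toScaffoldingData.tree.A, 𝒢.base.rev (π.onA α) ≠ π.onA α →
    ∃ Ψ, toScaffoldingData.IsBundleMap α Ψ ∧ 𝒢.IsAdhesionMap (π.onA α) Ψ
  adhesion_of_eq : ∀ α : toScaffoldingData.tree.A, 𝒢.base.rev (π.onA α) = π.onA α →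
    ∃ Ψ Ψ', toScaffoldingData.IsBundleMap α Ψ ∧
      toScaffoldingData.IsBundleMap (toScaffoldingData.tree.rev α) Ψ' ∧
      ((𝒢.IsAdhesionMap _ Ψ ∧ 𝒢.IsTwistedAdhesionMap _ Ψ') ∨
        (𝒢.IsTwistedAdhesionMap _ Ψ ∧ 𝒢.IsAdhesionMap _ Ψ'))
  /-- each `b`-adhesion set is met by exactly one arc bundle over `b` ending in a given vertex
  bundle; here `p(t(α))` is the set `Ψ_α(p(α))` -/
  existsUnique_arc : ∀ (τ : toScaffoldingData.tree.V) (b : 𝒢.base.A), 𝒢.base.t b = π.onV τ →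
    ∀ D : Set (𝒢.X (𝒢.base.t b)), 𝒢.IsAdhesionSet b D →
      ∃! α : toScaffoldingData.tree.A, π.onA α = b ∧ toScaffoldingData.tree.t α = τ ∧
        (fun c => pV (graph.t c)) '' {c | toScaffoldingData.bunA c = α} =
          Sigma.mk (𝒢.base.t b) '' D

namespace Scaffolding

variable {𝒢 : GraphOfGroupActions.{u, v, w, x}} (S : Scaffolding.{u, v, w, x, y, z} 𝒢)

/-- The universal group: the group of acceptable scaffolding automorphisms. -/
def universalGroup : Subgroup S.scAut where
  carrier := {g | S.IsAcceptable g.1}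
  one_mem' := fun τ => ⟨1, one_mem _, fun _ _ _ h => h⟩
  mul_mem' := by
    intro g h hg hh
    simp only [Set.mem_ofPred_eq, ScaffoldingData.isAcceptable_iff] at hg hh ⊢
    intro τ p hp
    have hτ : S.π.onV (S.treePerm h τ) = p := by
      obtain ⟨q⟩ := τ
      exact (h.2.2.2.1 q).trans hp
    obtain ⟨σ, hσ, hσ'⟩ := hg _ p hτ
    obtain ⟨ρ, hρ, hρ'⟩ := hh τ p hp
    refine ⟨σ * ρ, mul_mem hσ hρ, fun q hq ξ hξ => hσ' (h.1.1 q) ?_ _ (hρ' q hq ξ hξ)⟩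
    rw [← hq, S.treePerm_bunV]
  inv_mem' := by
    intro g hg
    simp only [Set.mem_ofPred_eq, ScaffoldingData.isAcceptable_iff] at hg ⊢
    intro τ p hp
    have hτ : S.π.onV (S.treePerm g⁻¹ τ) = p := by
      obtain ⟨q⟩ := τ
      exact (g⁻¹.2.2.2.1 q).trans hp
    obtain ⟨σ, hσ, hσ'⟩ := hg _ p hτ
    refine ⟨σ⁻¹, inv_mem hσ, fun q hq ξ hξ => ?_⟩
    have hb : S.bunV ((g⁻¹).1.1 q) = S.treePerm g⁻¹ τ := by rw [← hq, S.treePerm_bunV]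
    have hm := (S.pV_bijOn _).mapsTo hb
    rw [hτ] at hm
    obtain ⟨ζ, hζ⟩ := hm
    have h1 := hσ' _ hb ζ hζ.symm
    have h2 : g.1.1 ((g⁻¹).1.1 q) = q := perm_apply_inv g.1.1 q
    rw [h2, hξ] at h1
    have h3 : ξ = σ ζ := eq_of_heq (Sigma.mk.inj h1).2
    rw [← hζ, h3]
    exact congrArg _ (Equiv.symm_apply_apply σ ζ).symm

/-- The group of automorphisms of the tree `T` induced by the universal group. -/
def treeGroup : Subgroup (S.tree.toSimple ≃g S.tree.toSimple) :=
  S.universalGroup.map S.treeHom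

end Scaffolding

/-! ### Property (IP_k) for groups of automorphisms of trees -/

section PropertyIP

variable {V : Type u} (T : SimpleGraph V)

/-- The set `B(C, n)` of vertices at distance at most `n` from a vertex in `C`. -/
def ballAround (C : Set V) (n : ℕ) : Set V := {q | ∃ p ∈ C, T.dist q p ≤ n}

/-- The vertices whose closest vertex in `C` is `p`, for `p ∈ C`. -/
def branchAt (C : Set V) (p : V) : Set V := {q | ∀ r ∈ C, T.dist q p ≤ T.dist q r}

theorem dist_iso_apply (g : T ≃g T) (p q : V) : T.dist (g p) (g q) = T.dist p q := by
  rw [SimpleGraph.dist_eq_sInf, SimpleGraph.dist_eq_sInf]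
  congr 1
  ext n
  constructor
  · rintro ⟨W, rfl⟩
    exact ⟨(W.map g.symm.toHom).copy (g.symm_apply_apply p) (g.symm_apply_apply q), by simp⟩
  · rintro ⟨W, rfl⟩
    exact ⟨W.map g.toHom, by simp⟩

/-- `F_C` (depending on `k`): the pointwise stabiliser of `B(C, k - 1)` in `G`. -/
def ballFixator (G : Subgroup (T ≃g T)) (k : ℕ) (C : Set V) : Subgroup (T ≃g T) :=
  G ⊓ fixingSubgroup (T ≃g T) (ballAround T C (k - 1))

variable {T}

theorem ballFixator_apply {G : Subgroup (T ≃g T)} {k : ℕ} {C : Set V} {g : T ≃g T}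
    (hg : g ∈ ballFixator T G k C) {p : V} (hp : p ∈ C) : g p = p :=
  (mem_fixingSubgroup_iff _).1 hg.2 p ⟨p, hp, by simp⟩

theorem mem_branchAt_iff {G : Subgroup (T ≃g T)} {k : ℕ} {C : Set V} {g : T ≃g T}
    (hg : g ∈ ballFixator T G k C) {p : V} (hp : p ∈ C) (q : V) :
    g q ∈ branchAt T C p ↔ q ∈ branchAt T C p := by
  have key : ∀ r ∈ C, T.dist (g q) r = T.dist q r := fun r hr => by
    conv_lhs => rw [← ballFixator_apply hg hr]
    exact dist_iso_apply T g q r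
  simp only [branchAt, Set.mem_ofPred_eq]
  refine forall₂_congr fun r hr => ?_
  rw [key r hr, key p hp]

/-- Restriction of elements of `F_C` to the branch at `p`. -/
def restrictBranch (G : Subgroup (T ≃g T)) (k : ℕ) (C : Set V) (p : C) :
    ballFixator T G k C →* Perm (branchAt T C p) where
  toFun g := Perm.subtypePerm g.1.toEquiv fun q => mem_branchAt_iff g.2 p.2 q
  map_one' := by ext; rfl
  map_mul' _ _ := by ext; rfl

/-- The homomorphism `F_C → ∏_{p ∈ C} F_{C,p}` given by restriction to the branches, where
`F_{C,p}` is the permutation group that `F_C` induces on the branch at `p`. -/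
def branchHom (G : Subgroup (T ≃g T)) (k : ℕ) (C : Set V) :
    ballFixator T G k C →* ∀ p : C, (restrictBranch G k C p).range :=
  MonoidHom.pi fun p => (restrictBranch G k C p).rangeRestrict

variable (T)

/-- Property (IP_k) for a group `G` of automorphisms of a tree `T` (and `k ≥ 1`): the homomorphism
`F_C → ∏_{p ∈ C} F_{C,p}` is an isomorphism for every path `C` of length 1. -/
def HasPropertyIP (G : Subgroup (T ≃g T)) (k : ℕ) : Prop :=
  ∀ p q : V, T.Adj p q → Function.Bijective (branchHom G k {p, q})

end PropertyIP

/-! The two branches at an edge cover the tree, so injectivity of the restriction map is clear. For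
surjectivity it suffices that every element of `F_C` can be replaced by the identity on one branch
and kept on the other; products of such elements then realise every pair of restrictions. The
obstacle is that a group element fixing an edge of the tree may still move scaffolding vertices in
the bundles at its ends, so it cannot simply be cut there.

The remedy is to correct it first. If some element acts trivially on the tree but agrees with `g` on
the bundle `τ`, dividing it out leaves the tree action of `g` unchanged and makes `g` fix the bundle
pointwise (`exists_trivial_on_tree`). The result can be cut along the edge: its local actions stay
in the given groups, and no arc of the scaffolding is torn (`exists_trivial_on_branch`).

The correction is built by propagating the local action of `g` at `τ` outwards. An element trivial
on the tree preserves every adhesion set, so the permutation it induces on each `Y(a)` must be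
induced by an element at the next vertex that again preserves all adhesion sets, and so on.
`IsExtendable n` records this to depth `n`, in terms of the graph of group actions alone. The sets
of extendable permutations decrease with `n` inside finitely many finite symmetric groups, so they
are constant from some depth `N` on (`exists_isExtendable_stable`). At depth `N`, passing to a
neighbour loses no depth (`exists_neighbour_extension`), so the process never gets stuck, and the
absence of cycles makes the choices compatible (`exists_coherent_choice`). Fixing the ball of radius
`N + 1` around `τ` provides depth `N` at the start (`isLocallyExtendable_of_fixes`). Hence `k = N +
2`. -/

/-! ### Trees -/

section Tree

variable {V : Type u} {T : SimpleGraph V}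

/-- A vertex at least as close to `p` as to `q` is joined to `p` by a walk avoiding the edge
`{p, q}`. -/
theorem reachable_deleteEdges_of_dist_le (hT : T.Connected) {p q s : V} (hpq : p ≠ q)
    (h : T.dist s p ≤ T.dist s q) : (T.deleteEdges {s(p, q)}).Reachable s p := by
  classical
  obtain ⟨W, hW⟩ := hT.exists_walk_length_eq_dist s p
  refine ⟨W.toDeleteEdge _ fun he => ?_⟩
  have hq : q ∈ W.support := W.snd_mem_support_of_mem_edges he
  have h1 := T.dist_le (W.takeUntil q hq)
  have h2 := W.length_takeUntil_lt_length hq hpq.symm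
  omega

/-- An edge `{s, s'}` of a tree that crosses from the branch at `p` to the branch at `q`, for an
edge `{p, q}`, is the edge `{p, q}`. -/
theorem eq_of_adj_of_dist_le (hT : T.IsTree) {p q s s' : V} (hpq : T.Adj p q) (hs : T.Adj s s')
    (h : T.dist s p ≤ T.dist s q) (h' : T.dist s' q ≤ T.dist s' p) : s = p ∧ s' = q := by
  have hb := (SimpleGraph.isAcyclic_iff_forall_adj_isBridge.1 hT.isAcyclic) hpq
  rw [SimpleGraph.isBridge_iff] at hb
  have hq := reachable_deleteEdges_of_dist_le hT.connected hpq.ne' h'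
  rw [Sym2.eq_swap] at hq
  have hp := reachable_deleteEdges_of_dist_le hT.connected hpq.ne h
  -- If `{s, s'}` were another edge, it would survive the deletion of the bridge `{p, q}` and join
  -- its two sides.
  by_cases he : s(s, s') = s(p, q)
  · rcases Sym2.eq_iff.1 he with h1 | ⟨rfl, rfl⟩
    · exact h1
    · rw [T.dist_self, Nat.le_zero, hT.connected.dist_eq_zero_iff] at h
      exact ⟨h, h.symm⟩
  · refine absurd ((hp.symm.trans (SimpleGraph.Adj.reachable ?_)).trans hq) hb
    exact SimpleGraph.deleteEdges_adj.2 ⟨hs, he⟩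

/-- In a tree the neighbour of a vertex that is closer to a given root is unique. -/
theorem eq_of_adj_of_dist_eq (hT : T.IsTree) {r p q q' : V} (hq : T.Adj q p) (hq' : T.Adj q' p)
    (h : T.dist r p = T.dist r q + 1) (h' : T.dist r p = T.dist r q' + 1) : q = q' := by
  by_contra hne
  have hb := (SimpleGraph.isAcyclic_iff_forall_adj_isBridge.1 hT.isAcyclic) hq
  rw [SimpleGraph.isBridge_iff] at hb
  have h1 := reachable_deleteEdges_of_dist_le hT.connected hq.ne (s := r) (by omega)
  refine hb (h1.symm.trans (SimpleGraph.Reachable.trans (v := q') ?_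
    (SimpleGraph.Adj.reachable (SimpleGraph.deleteEdges_adj.2 ⟨hq', fun he => ?_⟩))))
  · classical
    obtain ⟨W, hW⟩ := hT.connected.exists_walk_length_eq_dist r q'
    refine ⟨W.toDeleteEdge _ fun he => ?_⟩
    have h2 := T.dist_le (W.takeUntil p (W.snd_mem_support_of_mem_edges he))
    have h3 := W.length_takeUntil_le_length (W.snd_mem_support_of_mem_edges he)
    omega
  · rcases Sym2.eq_iff.1 he with h2 | h2
    · exact hne h2.1.symm
    · exact hq.ne' h2.2

theorem exists_adj_dist_eq (hT : T.Connected) {r p : V} (h : p ≠ r) :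
    ∃ q, T.Adj q p ∧ T.dist r p = T.dist r q + 1 := by
  obtain ⟨W, hW⟩ := hT.exists_walk_length_eq_dist p r
  cases W with
  | nil => exact absurd rfl h
  | @cons _ q _ hq W =>
    refine ⟨q, hq.symm, ?_⟩
    have h1 := T.dist_le W
    have h2 := hT.dist_triangle (u := r) (v := q) (w := p)
    rw [SimpleGraph.dist_eq_one_iff_adj.2 hq.symm] at h2
    rw [SimpleGraph.Walk.length_cons] at hW
    rw [T.dist_comm (u := p)] at hW
    rw [T.dist_comm (u := q)] at h1
    omega

/-- States on the vertices of a tree that can be propagated along edges can be chosen coherently,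
with a prescribed state at a given vertex. -/
theorem SimpleGraph.IsTree.exists_coherent_choice (hT : T.IsTree) {X : V → Type v}
    (R : ∀ p q, X p → X q → Prop) (symm : ∀ p q a b, R p q a b → R q p b a)
    (step : ∀ p q, T.Adj p q → ∀ a, ∃ b, R p q a b) (r : V) (a₀ : X r) :
    ∃ s : ∀ p, X p, s r = a₀ ∧ ∀ p q, T.Adj p q → R p q (s p) (s q) := by
  classical
  choose f hf using step
  choose! par hpar using fun p (h : p ≠ r) => exists_adj_dist_eq hT.connected h
  -- Recursion on the distance from the root: each state is obtained from that of the parent by one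
  -- step.
  let F : ∀ p, (∀ q, T.dist r q < T.dist r p → X q) → X p := fun p rec =>
    if h : p = r then h ▸ a₀
    else f (par p) p (hpar p h).1 (rec (par p) (by have := (hpar p h).2; omega))
  let s : ∀ p, X p := (measure fun p => T.dist r p).wf.fix F
  have hs : ∀ p, s p = F p fun q _ => s q := fun p => WellFounded.fix_eq _ _ _
  have hsr : s r = a₀ := by rw [hs]; simp [F]
  have key : ∀ p q, T.Adj p q → T.dist r q = T.dist r p + 1 → R p q (s p) (s q) := by
    intro p q hpq hd
    have hq : q ≠ r := by rintro rfl; simp at hd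
    -- The closer neighbour is unique, so every edge is a parent edge and no further compatibility
    -- has to be checked.
    have hp : p = par q := eq_of_adj_of_dist_eq hT hpq (hpar q hq).1 hd (hpar q hq).2
    subst hp
    rw [hs q]
    simp only [F, dif_neg hq]
    exact hf _ _ hpq _
  refine ⟨s, hsr, fun p q hpq => ?_⟩
  rcases hT.dist_eq_dist_add_one_of_adj r hpq with h | h
  · exact symm _ _ _ _ (key q p hpq.symm h)
  · exact key p q hpq h

end Tree

theorem perm_inv_apply {α : Type u} (f : Perm α) (a : α) : f⁻¹ (f a) = a :=
  Equiv.symm_apply_apply f a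

/-! ### Locally extendable permutations -/

namespace GraphOfGroupActions

variable (𝒢 : GraphOfGroupActions.{u, v, w, x})

/-- The embedding `Φ_a`, for given names of the edge and the terminus of `a`. -/
def ΦOf (a : 𝒢.base.A) {e : 𝒢.base.Edge} {p : 𝒢.base.V} (he : 𝒢.base.edge a = e)
    (hp : 𝒢.base.t a = p) (y : 𝒢.Y e) : 𝒢.X p :=
  cast (congrArg 𝒢.X hp) (𝒢.Φ a (cast (congrArg 𝒢.Y he.symm) y))

theorem ΦOf_embedding (a : 𝒢.base.A) {e : 𝒢.base.Edge} {p : 𝒢.base.V} (he : 𝒢.base.edge a = e)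
    (hp : 𝒢.base.t a = p) : IsActionEmbedding (𝒢.H e) (𝒢.G p) (𝒢.ΦOf a he hp) := by
  subst he hp
  exact 𝒢.Φ_embedding a

open Classical in
/-- The inversion agent of a self-reverse arc, and the identity for other arcs. -/
noncomputable def twist (a : 𝒢.base.A) : Perm (𝒢.Y (𝒢.base.edge a)) :=
  if ha : 𝒢.base.rev a = a then 𝒢.agent a ha else 1

theorem twist_of_eq {a : 𝒢.base.A} (ha : 𝒢.base.rev a = a) : 𝒢.twist a = 𝒢.agent a ha :=
  dif_pos ha

theorem twist_of_ne {a : 𝒢.base.A} (ha : 𝒢.base.rev a ≠ a) : 𝒢.twist a = 1 :=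
  dif_neg ha

theorem twist_conj_mem (a : 𝒢.base.A) {m : Perm (𝒢.Y (𝒢.base.edge a))}
    (hm : m ∈ 𝒢.H (𝒢.base.edge a)) :
    𝒢.twist a * m * (𝒢.twist a)⁻¹ ∈ 𝒢.H (𝒢.base.edge a) := by
  by_cases ha : 𝒢.base.rev a = a
  · rw [𝒢.twist_of_eq ha]
    exact (𝒢.agent_conj a ha m).1 hm
  · simpa [𝒢.twist_of_ne ha] using hm

/-- The embedding at the origin of `a`, twisted by the inversion agent if `a` is self-reverse. -/
noncomputable def Φop (a : 𝒢.base.A) (y : 𝒢.Y (𝒢.base.edge a)) : 𝒢.X (𝒢.base.o a) :=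
  𝒢.ΦOf (𝒢.base.rev a) (𝒢.base.edge_rev a) (𝒢.base.t_rev a) (𝒢.twist a y)

/-- The agent normalises `H(a)`, so twisting by it does not affect which elements of `H(a)` are
realised at the origin. -/
theorem exists_apply_Φop (a : 𝒢.base.A) {m : Perm (𝒢.Y (𝒢.base.edge a))}
    (hm : m ∈ 𝒢.H (𝒢.base.edge a)) :
    ∃ δ ∈ 𝒢.G (𝒢.base.o a), ∀ y, δ (𝒢.Φop a y) = 𝒢.Φop a (m y) := by
  obtain ⟨δ, hδ, h⟩ := ((𝒢.ΦOf_embedding _ (𝒢.base.edge_rev a) (𝒢.base.t_rev a)).2 _).1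
    (𝒢.twist_conj_mem a hm)
  exact ⟨δ, hδ, fun y => (h _).trans (by simp [Φop])⟩

/-- Translates of `Φ_a` with the same image differ by an element of `H(a)`. -/
theorem exists_mem_H_of_range_eq {a : 𝒢.base.A} {γ γ' : Perm (𝒢.X (𝒢.base.t a))}
    (hγ : γ ∈ 𝒢.G (𝒢.base.t a)) (hγ' : γ' ∈ 𝒢.G (𝒢.base.t a))
    (h : Set.range (fun y => γ (𝒢.Φ a y)) = Set.range fun y => γ' (𝒢.Φ a y)) :
    ∃ m ∈ 𝒢.H (𝒢.base.edge a), ∀ y, γ (𝒢.Φ a y) = γ' (𝒢.Φ a (m y)) := by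
  have hi : ∀ δ : Perm (𝒢.X (𝒢.base.t a)), Function.Injective fun y => δ (𝒢.Φ a y) :=
    fun δ => δ.injective.comp (𝒢.Φ_embedding a).1
  let m : Perm (𝒢.Y (𝒢.base.edge a)) :=
    (Equiv.ofInjective _ (hi γ)).trans
      ((Equiv.setCongr h).trans (Equiv.ofInjective _ (hi γ')).symm)
  have hm : ∀ y, γ (𝒢.Φ a y) = γ' (𝒢.Φ a (m y)) := fun y =>
    (congrArg Subtype.val ((Equiv.ofInjective _ (hi γ')).apply_symm_apply
      (Equiv.setCongr h (Equiv.ofInjective _ (hi γ) y)))).symm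
  refine ⟨m, ((𝒢.Φ_embedding a).2 m).2 ⟨γ'⁻¹ * γ, mul_mem (inv_mem hγ') hγ, fun y => ?_⟩, hm⟩
  rw [Perm.mul_apply, hm, perm_inv_apply]

/-- `h` is induced by an element of `G(o(a))` that preserves all adhesion sets, in such a way that
the permutations induced at the adhesion sets have the same property, and so on, `n` times. -/
def IsExtendable : ℕ → ∀ a : 𝒢.base.A, Perm (𝒢.Y (𝒢.base.edge a)) → Prop
  | 0, _, _ => True
  | n + 1, a, h => ∃ g ∈ 𝒢.G (𝒢.base.o a), (∀ y, g (𝒢.Φop a y) = 𝒢.Φop a (h y)) ∧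
      ∀ b (hb : 𝒢.base.t b = 𝒢.base.o a), ∀ γ ∈ 𝒢.G (𝒢.base.o a),
        ∃ h', (∀ y, g (γ (𝒢.ΦOf b rfl hb y)) = γ (𝒢.ΦOf b rfl hb (h' y))) ∧ IsExtendable n b h'

/-- `g` preserves all adhesion sets and induces extendable permutations at them. -/
def IsLocallyExtendable (n : ℕ) (p : 𝒢.base.V) (g : Perm (𝒢.X p)) : Prop :=
  ∀ b (hb : 𝒢.base.t b = p), ∀ γ ∈ 𝒢.G p,
    ∃ h', (∀ y, g (γ (𝒢.ΦOf b rfl hb y)) = γ (𝒢.ΦOf b rfl hb (h' y))) ∧ 𝒢.IsExtendable n b h'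

variable {𝒢}

theorem IsLocallyExtendable.conj {n : ℕ} {p : 𝒢.base.V} {g δ : Perm (𝒢.X p)}
    (hg : 𝒢.IsLocallyExtendable n p g) (hδ : δ ∈ 𝒢.G p) :
    𝒢.IsLocallyExtendable n p (δ⁻¹ * g * δ) := by
  intro b hb γ hγ
  obtain ⟨h', h1, h2⟩ := hg b hb (δ * γ) (mul_mem hδ hγ)
  refine ⟨h', fun y => ?_, h2⟩
  have := h1 y
  simp only [Perm.mul_apply] at this ⊢
  rw [this, perm_inv_apply]

/-- An adhesion set determines its adhesion maps only up to `H(a)`. This invariance makes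
extendability independent of the parametrisation chosen. -/
theorem IsExtendable.conj {n : ℕ} {a : 𝒢.base.A} {h m : Perm (𝒢.Y (𝒢.base.edge a))}
    (hh : 𝒢.IsExtendable n a h) (hm : m ∈ 𝒢.H (𝒢.base.edge a)) :
    𝒢.IsExtendable n a (m⁻¹ * h * m) := by
  cases n with
  | zero => trivial
  | succ n =>
    obtain ⟨g, hg, h1, h2⟩ := hh
    obtain ⟨δ, hδ, h3⟩ := 𝒢.exists_apply_Φop a hm
    refine ⟨δ⁻¹ * g * δ, mul_mem (mul_mem (inv_mem hδ) hg) hδ, fun y => ?_,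
      IsLocallyExtendable.conj h2 hδ⟩
    simp only [Perm.mul_apply]
    rw [h3, h1, Perm.inv_eq_iff_eq, h3, perm_apply_inv]

theorem IsExtendable.of_succ {n : ℕ} {a : 𝒢.base.A} {h : Perm (𝒢.Y (𝒢.base.edge a))}
    (hh : 𝒢.IsExtendable (n + 1) a h) : 𝒢.IsExtendable n a h := by
  induction n generalizing a with
  | zero => trivial
  | succ n ih =>
    obtain ⟨g, hg, h1, h2⟩ := hh
    refine ⟨g, hg, h1, fun b hb γ hγ => ?_⟩
    obtain ⟨h', h3, h4⟩ := h2 b hb γ hγ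
    exact ⟨h', h3, ih h4⟩

variable (𝒢)

/-- Extendability becomes independent of the depth. -/
theorem exists_isExtendable_stable (hA : Finite 𝒢.base.A)
    (hY : ∀ a, Finite (𝒢.Y (𝒢.base.edge a))) :
    ∃ N, ∀ a h, 𝒢.IsExtendable N a h → 𝒢.IsExtendable (N + 1) a h := by
  -- One chain treats all arcs at once, giving a common depth; the order dual turns the decreasing
  -- chain in a finite set into an increasing one.
  let f : ℕ →o (∀ a, Set (Perm (𝒢.Y (𝒢.base.edge a))))ᵒᵈ :=
    ⟨fun n => OrderDual.toDual fun a => {h | 𝒢.IsExtendable n a h},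
      monotone_nat_of_le_succ fun n a h hh => IsExtendable.of_succ hh⟩
  obtain ⟨N, hN⟩ := WellFoundedGT.monotone_chain_condition f
  refine ⟨N, fun a h hh => ?_⟩
  have := congrFun (congrArg OrderDual.ofDual (hN (N + 1) (Nat.le_succ N))) a
  exact (Set.ext_iff.1 this h).1 hh

end GraphOfGroupActions

/-! ### Arcs and local actions in scaffoldings -/

namespace ScaffoldingData

variable {𝒢 : GraphOfGroupActions.{u, v, w, x}} (S : ScaffoldingData.{u, v, w, x, y, z} 𝒢)

variable {S} in
theorem IsBundleMap.of_isAdhesionMap {α : S.tree.A} {a : 𝒢.base.A} {e : 𝒢.base.Edge}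
    {p : 𝒢.base.V} (hα : S.π.onA α = a) (he : 𝒢.base.edge a = e) (hp : 𝒢.base.t a = p)
    {Ψ : 𝒢.Y (𝒢.base.edge (S.π.onA α)) → 𝒢.X (𝒢.base.t (S.π.onA α))}
    (hΨ : S.IsBundleMap α Ψ) (hA : 𝒢.IsAdhesionMap _ Ψ) :
    ∃ γ ∈ 𝒢.G p, ∀ c, S.bunA c = α → ∀ y, S.pA c = ⟨e, y⟩ →
      S.pV (S.graph.t c) = ⟨p, γ (𝒢.ΦOf a he hp y)⟩ := by
  subst hα he hp
  obtain ⟨γ, hγ, h⟩ := hA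
  exact ⟨γ, hγ, fun c hc y hy => (hΨ c hc y hy).trans (by rw [h]; rfl)⟩

variable {S} in
theorem IsBundleMap.of_isTwistedAdhesionMap {α : S.tree.A} {a : 𝒢.base.A}
    (hα : S.π.onA α = a) {Ψ : 𝒢.Y (𝒢.base.edge (S.π.onA α)) → 𝒢.X (𝒢.base.t (S.π.onA α))}
    (hΨ : S.IsBundleMap α Ψ) (hA : 𝒢.IsTwistedAdhesionMap _ Ψ) :
    ∃ γ ∈ 𝒢.G (𝒢.base.t a), ∀ c, S.bunA c = α → ∀ y, S.pA c = ⟨𝒢.base.edge a, y⟩ →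
      S.pV (S.graph.t c) = ⟨𝒢.base.t a, γ (𝒢.Φ a (𝒢.twist a y))⟩ := by
  subst hα
  obtain ⟨ha, γ, hγ, h⟩ := hA
  exact ⟨γ, hγ, fun c hc y hy => (hΨ c hc y hy).trans (by rw [h, 𝒢.twist_of_eq ha])⟩

/-- `f` acts on the bundle `τ`, which lies over `p`, as the permutation `σ` of `X(p)`. -/
def ActsAs (f : S.graph.V → S.graph.V) (τ : S.tree.V) (p : 𝒢.base.V) (σ : Perm (𝒢.X p)) : Prop :=
  ∀ q, S.bunV q = τ → ∀ ξ, S.pV q = ⟨p, ξ⟩ → S.pV (f q) = ⟨p, σ ξ⟩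

end ScaffoldingData

theorem GraphOfGroupActions.exists_ΦOf_eq {𝒢 : GraphOfGroupActions.{u, v, w, x}}
    {a a' : 𝒢.base.A} {p : 𝒢.base.V} (ha : a' = a) (he : 𝒢.base.edge a' = 𝒢.base.edge a)
    (hp : 𝒢.base.t a' = p) {γ : Perm (𝒢.X (𝒢.base.t a))} (hγ : γ ∈ 𝒢.G (𝒢.base.t a)) :
    ∃ δ ∈ 𝒢.G p, ∀ y, (⟨𝒢.base.t a, γ (𝒢.Φ a y)⟩ : Σ p, 𝒢.X p) = ⟨p, δ (𝒢.ΦOf a' he hp y)⟩ := by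
  subst ha hp
  exact ⟨γ, hγ, fun y => rfl⟩

namespace Scaffolding

variable {𝒢 : GraphOfGroupActions.{u, v, w, x}} (S : Scaffolding.{u, v, w, x, y, z} 𝒢)

/-- The maps from an arc bundle to the vertex bundles at its ends are, up to a common permutation
of `Y(a)`, translates of the standard embeddings. -/
theorem exists_bundle_maps (α : S.tree.A) :
    ∃ k : Perm (𝒢.Y (𝒢.base.edge (S.π.onA α))), ∃ γ ∈ 𝒢.G (𝒢.base.t (S.π.onA α)),
      ∃ δ ∈ 𝒢.G (𝒢.base.o (S.π.onA α)), ∀ c, S.bunA c = α →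
        ∀ y, S.pA c = ⟨𝒢.base.edge (S.π.onA α), y⟩ →
          S.pV (S.graph.t c) = ⟨𝒢.base.t (S.π.onA α), γ (𝒢.Φ (S.π.onA α) (k y))⟩ ∧
          S.pV (S.graph.o c) = ⟨𝒢.base.o (S.π.onA α), δ (𝒢.Φop (S.π.onA α) (k y))⟩ := by
  have hrev : S.π.onA (S.tree.rev α) = 𝒢.base.rev (S.π.onA α) := S.π.map_rev α
  have hc : ∀ c, S.bunA c = α → S.bunA (S.graph.rev c) = S.tree.rev α := by
    rintro c rfl
    rfl
  by_cases ha : 𝒢.base.rev (S.π.onA α) = S.π.onA α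
  · obtain ⟨Ψ, Ψ', hΨ, hΨ', h | h⟩ := S.adhesion_of_eq α ha
    · obtain ⟨γ, hγ, h1⟩ := hΨ.of_isAdhesionMap rfl rfl rfl h.1
      obtain ⟨δ₀, hδ₀, h2⟩ := hΨ'.of_isTwistedAdhesionMap (hrev.trans ha) h.2
      obtain ⟨δ, hδ, h3⟩ := 𝒢.exists_ΦOf_eq ha (𝒢.base.edge_rev _) (𝒢.base.t_rev _) hδ₀
      refine ⟨1, γ, hγ, δ, hδ, fun c hcα y hy => ⟨h1 c hcα y hy, ?_⟩⟩
      have := h2 _ (hc c hcα) y ((S.pA_rev c).trans hy)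
      rw [S.graph.t_rev] at this
      exact this.trans (h3 _)
    · obtain ⟨γ, hγ, h1⟩ := hΨ.of_isTwistedAdhesionMap rfl h.1
      obtain ⟨δ, hδ, h2⟩ := hΨ'.of_isAdhesionMap hrev (𝒢.base.edge_rev _) (𝒢.base.t_rev _) h.2
      have hsq := 𝒢.agent_sq _ ha
      rw [← 𝒢.twist_of_eq ha, (𝒢.ΦOf_embedding _ (𝒢.base.edge_rev _) (𝒢.base.t_rev _)).2] at hsq
      obtain ⟨ε, hε, h3⟩ := hsq
      -- Relabelling by the agent absorbs the twist at the terminus. The origin then sees the square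
      -- of the agent, which lies in `H(a)` and is undone by `ε⁻¹`.
      refine ⟨𝒢.twist _, γ, hγ, δ * ε⁻¹, mul_mem hδ (inv_mem hε),
        fun c hcα y hy => ⟨h1 c hcα y hy, ?_⟩⟩
      have := h2 _ (hc c hcα) y ((S.pA_rev c).trans hy)
      rw [S.graph.t_rev] at this
      rw [this]
      have h4 := h3 y
      rw [Perm.mul_apply] at h4
      rw [GraphOfGroupActions.Φop, ← h4, Perm.mul_apply, perm_inv_apply]
  · obtain ⟨Ψ, hΨ, h⟩ := S.adhesion_of_ne α ha
    obtain ⟨Ψ', hΨ', h'⟩ := S.adhesion_of_ne (S.tree.rev α) (by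
      rw [hrev, 𝒢.base.rev_rev]
      exact Ne.symm ha)
    obtain ⟨γ, hγ, h1⟩ := hΨ.of_isAdhesionMap rfl rfl rfl h
    obtain ⟨δ, hδ, h2⟩ := hΨ'.of_isAdhesionMap hrev (𝒢.base.edge_rev _) (𝒢.base.t_rev _) h'
    refine ⟨1, γ, hγ, δ, hδ, fun c hcα y hy => ⟨h1 c hcα y hy, ?_⟩⟩
    have := h2 _ (hc c hcα) y ((S.pA_rev c).trans hy)
    rw [S.graph.t_rev] at this
    rw [this, GraphOfGroupActions.Φop, 𝒢.twist_of_ne ha]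
    rfl

/-! ### Recovering vertices and arcs from their bundles, colours and ends. -/

theorem tree_arc_ext {α β : S.tree.A} (ho : S.tree.o α = S.tree.o β)
    (ht : S.tree.t α = S.tree.t β) : α = β :=
  S.isTree.1.2 (Prod.ext ho ht)

theorem eq_of_pV_eq {q r : S.graph.V} (h : S.bunV q = S.bunV r) (hp : S.pV q = S.pV r) : q = r :=
  (S.pV_bijOn (S.bunV r)).injOn h rfl hp

theorem exists_pV_eq {q : S.graph.V} {τ : S.tree.V} {p : 𝒢.base.V} (hq : S.bunV q = τ)
    (hp : S.π.onV τ = p) : ∃ ξ, S.pV q = ⟨p, ξ⟩ := by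
  subst hp
  obtain ⟨ξ, h⟩ := (S.pV_bijOn τ).mapsTo hq
  exact ⟨ξ, h.symm⟩

theorem exists_of_color {τ : S.tree.V} {p : 𝒢.base.V} (hp : S.π.onV τ = p) (ξ : 𝒢.X p) :
    ∃ q, S.bunV q = τ ∧ S.pV q = ⟨p, ξ⟩ := by
  subst hp
  exact (S.pV_bijOn τ).surjOn ⟨ξ, rfl⟩

theorem exists_pA_eq {c : S.graph.A} {α : S.tree.A} (hc : S.bunA c = α) :
    ∃ y, S.pA c = ⟨𝒢.base.edge (S.π.onA α), y⟩ := by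
  obtain ⟨y, h⟩ := (S.pA_bijOn α).mapsTo hc
  exact ⟨y, h.symm⟩

theorem exists_arc_of_color (α : S.tree.A) (y : 𝒢.Y (𝒢.base.edge (S.π.onA α))) :
    ∃ c, S.bunA c = α ∧ S.pA c = ⟨𝒢.base.edge (S.π.onA α), y⟩ :=
  (S.pA_bijOn α).surjOn ⟨y, rfl⟩

theorem arc_ext {c d : S.graph.A} (ho : S.graph.o c = S.graph.o d)
    (ht : S.graph.t c = S.graph.t d) : c = d := by
  have hb : S.bunA c = S.bunA d :=
    S.tree_arc_ext (congrArg S.bunV ho) (congrArg S.bunV ht)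
  obtain ⟨k, γ, -, δ, -, h⟩ := S.exists_bundle_maps (S.bunA d)
  obtain ⟨y, hy⟩ := S.exists_pA_eq hb
  obtain ⟨y', hy'⟩ := S.exists_pA_eq (c := d) rfl
  have h1 := (h c hb y hy).1
  rw [ht, (h d rfl y' hy').1] at h1
  have h2 := k.injective ((𝒢.Φ_embedding _).1 (γ.injective (eq_of_heq (Sigma.mk.inj h1).2)))
  refine (S.pA_bijOn _).injOn hb (show S.bunA d = S.bunA d from rfl) ?_
  rw [hy, hy', h2]

/-! ### Automorphisms that fix vertices or arcs of the tree. -/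

theorem bunV_eq_of_treePerm_eq {g : S.scAut} {τ : S.tree.V} (hg : S.treePerm g τ = τ)
    (q : S.graph.V) : S.bunV (g.1.1 q) = τ ↔ S.bunV q = τ := by
  rw [← S.treePerm_bunV]
  constructor
  · intro h
    exact (S.treePerm g).injective (h.trans hg.symm)
  · rintro rfl
    exact hg

theorem bunA_eq_of_treePerm_eq {g : S.scAut} {α : S.tree.A}
    (ho : S.treePerm g (S.tree.o α) = S.tree.o α) (ht : S.treePerm g (S.tree.t α) = S.tree.t α)
    (c : S.graph.A) : S.bunA (g.1.2 c) = α ↔ S.bunA c = α := by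
  have key : ∀ d, S.bunA d = α ↔
      S.bunV (S.graph.o d) = S.tree.o α ∧ S.bunV (S.graph.t d) = S.tree.t α := by
    intro d
    constructor
    · rintro rfl
      exact ⟨rfl, rfl⟩
    · exact fun h => S.tree_arc_ext h.1 h.2
  rw [key, key, (g.2.1 c).1, (g.2.1 c).2.1, S.bunV_eq_of_treePerm_eq ho,
    S.bunV_eq_of_treePerm_eq ht]

/-- A scaffolding automorphism that fixes an arc `α` of the tree induces a permutation of
`Y(π(α))`. -/
theorem exists_arc_action {g : S.scAut} {α : S.tree.A}
    (ho : S.treePerm g (S.tree.o α) = S.tree.o α) (ht : S.treePerm g (S.tree.t α) = S.tree.t α) :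
    ∃ h : Perm (𝒢.Y (𝒢.base.edge (S.π.onA α))), ∀ c, S.bunA c = α →
      ∀ y, S.pA c = ⟨𝒢.base.edge (S.π.onA α), y⟩ →
        S.bunA (g.1.2 c) = α ∧ S.pA (g.1.2 c) = ⟨𝒢.base.edge (S.π.onA α), h y⟩ := by
  have hfix := S.bunA_eq_of_treePerm_eq ho ht
  let e : 𝒢.Y (𝒢.base.edge (S.π.onA α)) ≃ {c // S.bunA c = α} :=
    (Equiv.ofInjective _ sigma_mk_injective).trans (Set.BijOn.equiv _ (S.pA_bijOn α)).symm
  have he : ∀ y, S.pA (e y).1 = ⟨𝒢.base.edge (S.π.onA α), y⟩ := fun y =>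
    congrArg Subtype.val ((Set.BijOn.equiv _ (S.pA_bijOn α)).apply_symm_apply
      (Equiv.ofInjective _ sigma_mk_injective y))
  refine ⟨(e.trans (g.1.2.subtypePerm hfix)).trans e.symm, fun c hc y hy => ?_⟩
  have hcy : (e y).1 = c := (S.pA_bijOn α).injOn (e y).2 hc ((he y).trans hy.symm)
  refine ⟨(hfix c).2 hc, ?_⟩
  rw [← he]
  simp [hcy]

theorem tree_adj (α : S.tree.A) : S.tree.toSimple.Adj (S.tree.o α) (S.tree.t α) :=
  ⟨S.isTree.1.1 α, α, rfl, rfl⟩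

/-- The local action of an element of the universal group that fixes a ball around a vertex of the
tree is locally extendable. -/
theorem isLocallyExtendable_of_fixes {g : S.scAut} (hg : g ∈ S.universalGroup) (n : ℕ)
    {τ : S.tree.V} {p : 𝒢.base.V} {σ : Perm (𝒢.X p)} (hp : S.π.onV τ = p)
    (hσ : S.ActsAs g.1.1 τ p σ)
    (hfix : ∀ ρ, S.tree.toSimple.dist ρ τ ≤ n + 1 → S.treePerm g ρ = ρ) :
    𝒢.IsLocallyExtendable n p σ := by
  induction n using Nat.strong_induction_on generalizing τ p σ with
  | _ n ih =>
  intro b hb γ hγ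
  subst hb
  obtain ⟨α, ⟨hα1, hα2, hα3⟩, -⟩ :=
    S.existsUnique_arc τ b hp.symm (γ '' Set.range (𝒢.Φ b)) ⟨γ, hγ, rfl⟩
  subst hα1 hα2
  obtain ⟨k, γ', hγ', δ, hδ, hc⟩ := S.exists_bundle_maps α
  have hd : S.tree.toSimple.dist (S.tree.o α) (S.tree.t α) = 1 :=
    SimpleGraph.dist_eq_one_iff_adj.2 (S.tree_adj α)
  obtain ⟨h, hh⟩ := S.exists_arc_action (hfix (S.tree.o α) (by omega))
    (hfix (S.tree.t α) (by simp))
  have hrange : Set.range (fun y => γ (𝒢.Φ _ y)) = Set.range fun y => γ' (𝒢.Φ _ y) := by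
    rw [← Set.range_comp] at hα3
    apply sigma_mk_injective.image_injective
    refine hα3.symm.trans ?_
    ext s
    constructor
    · rintro ⟨c, hcα, rfl⟩
      obtain ⟨y, hy⟩ := S.exists_pA_eq hcα
      exact ⟨_, ⟨k y, rfl⟩, (hc c hcα y hy).1.symm⟩
    · rintro ⟨_, ⟨y, rfl⟩, rfl⟩
      obtain ⟨c, hcα, hcy⟩ := S.exists_arc_of_color α (k⁻¹ y)
      refine ⟨c, hcα, (hc c hcα _ hcy).1.trans ?_⟩
      simp only [perm_apply_inv]
  -- The bundle `α` and the given `γ` may parametrise the same adhesion set differently; `m`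
  -- converts between them.
  obtain ⟨m, hm, hmγ⟩ := 𝒢.exists_mem_H_of_range_eq hγ hγ' hrange
  have hext : 𝒢.IsExtendable n (S.π.onA α) (k * h * k⁻¹) := by
    -- Depth `0` asks nothing beyond preserving the adhesion set. Otherwise, the ball around the
    -- neighbour with radius smaller by one lies in the fixed ball, so induction applies there.
    rcases n with _ | n
    · trivial
    obtain ⟨σ', hσ', hL⟩ := (S.isAcceptable_iff _).1 hg _ _ (S.π.map_o α)
    have hle := ih n (Nat.lt_succ_self n) (S.π.map_o α) hL fun ρ hρ => hfix ρ (by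
      change S.tree.toSimple.dist ρ (S.tree.o α) ≤ _ at hρ
      have := S.isTree.2.connected.dist_triangle (u := ρ) (v := S.tree.o α) (w := S.tree.t α)
      omega)
    refine ⟨δ⁻¹ * σ' * δ, mul_mem (mul_mem (inv_mem hδ) hσ') hδ, fun y => ?_, hle.conj hδ⟩
    obtain ⟨c, hcα, hcy⟩ := S.exists_arc_of_color α (k⁻¹ y)
    obtain ⟨h1, h2⟩ := hh c hcα _ hcy
    have h3 := hL _ (congrArg S.tree.o hcα) _ (hc c hcα _ hcy).2
    rw [← (g.2.1 c).1, (hc _ h1 _ h2).2] at h3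
    have h4 := eq_of_heq (Sigma.mk.inj h3).2
    simp only [Perm.mul_apply, perm_apply_inv] at h4 ⊢
    rw [← h4, perm_inv_apply]
  refine ⟨m⁻¹ * (k * h * k⁻¹) * m, fun y => ?_, hext.conj hm⟩
  obtain ⟨c, hcα, hcy⟩ := S.exists_arc_of_color α (k⁻¹ (m y))
  obtain ⟨h1, h2⟩ := hh c hcα _ hcy
  have h3 := hσ _ (congrArg S.tree.t hcα) _ (hc c hcα _ hcy).1
  rw [← (g.2.1 c).2.1, (hc _ h1 _ h2).1] at h3
  have h4 := eq_of_heq (Sigma.mk.inj h3).2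
  change σ (γ (𝒢.Φ _ y)) = γ (𝒢.Φ _ ((m⁻¹ * (k * h * k⁻¹) * m) y))
  rw [hmγ, hmγ]
  simp only [Perm.mul_apply, perm_apply_inv] at h4 ⊢
  exact h4.symm

end Scaffolding

/-! ### Constructing elements of the universal group -/

namespace Scaffolding

variable {𝒢 : GraphOfGroupActions.{u, v, w, x}} (S : Scaffolding.{u, v, w, x, y, z} 𝒢)

/-- A permutation of the vertices of a scaffolding that respects all the structure extends to an
element of the universal group. -/
theorem exists_mem_universalGroup (f : Perm S.graph.V)
    (hA : ∀ c, ∃ c', S.graph.o c' = f (S.graph.o c) ∧ S.graph.t c' = f (S.graph.t c) ∧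
      S.π.onA (S.bunA c') = S.π.onA (S.bunA c))
    (hA' : ∀ c, ∃ c', S.graph.o c' = f.symm (S.graph.o c) ∧ S.graph.t c' = f.symm (S.graph.t c))
    (hrel : ∀ q r, S.bunV (f q) = S.bunV (f r) ↔ S.bunV q = S.bunV r)
    (hπ : ∀ q, S.π.onV (S.bunV (f q)) = S.π.onV (S.bunV q))
    (hloc : ∀ τ, ∃ σ ∈ 𝒢.G (S.π.onV τ), S.ActsAs f τ (S.π.onV τ) σ) :
    ∃ g ∈ S.universalGroup, g.1.1 = f := by
  choose F hFo hFt hFπ using hA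
  choose F' hFo' hFt' using hA'
  -- Arcs are determined by their ends, so the chosen maps are automatically mutually inverse and
  -- compatible with reversal.
  let φ : Perm S.graph.A :=
    { toFun := F
      invFun := F'
      left_inv := fun c => S.arc_ext (by rw [hFo', hFo, f.symm_apply_apply])
        (by rw [hFt', hFt, f.symm_apply_apply])
      right_inv := fun c => S.arc_ext (by rw [hFo, hFo', f.apply_symm_apply])
        (by rw [hFt, hFt', f.apply_symm_apply]) }
  refine ⟨⟨(f, φ), fun c => ⟨hFo c, hFt c, S.arc_ext ?_ ?_⟩, fun q r => ?_, hπ, hFπ⟩, hloc, rfl⟩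
  · change S.graph.o (S.graph.rev (F c)) = S.graph.o (F (S.graph.rev c))
    rw [hFo, S.graph.o_rev, S.graph.o_rev, hFt]
  · change S.graph.t (S.graph.rev (F c)) = S.graph.t (F (S.graph.rev c))
    rw [hFt, S.graph.t_rev, S.graph.t_rev, hFo]
  · exact Quotient.eq.symm.trans ((hrel q r).symm.trans Quotient.eq)

/-- The permutations `σ` and `σ'` of the bundles at the ends of the arcs of the tree from `τ` to
`τ'` preserve the set of arcs of the scaffolding between these bundles. -/
def MapsArcs (τ τ' : S.tree.V) (σ : Perm (𝒢.X (S.π.onV τ))) (σ' : Perm (𝒢.X (S.π.onV τ'))) :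
    Prop :=
  ∀ c, S.bunV (S.graph.o c) = τ → S.bunV (S.graph.t c) = τ' →
    ∃ c', S.bunV (S.graph.o c') = τ ∧ S.bunV (S.graph.t c') = τ' ∧
      (∀ ξ, S.pV (S.graph.o c) = ⟨_, ξ⟩ → S.pV (S.graph.o c') = ⟨_, σ ξ⟩) ∧
      ∀ ξ, S.pV (S.graph.t c) = ⟨_, ξ⟩ → S.pV (S.graph.t c') = ⟨_, σ' ξ⟩

variable {S} in
theorem MapsArcs.symm {τ τ' : S.tree.V} {σ : Perm (𝒢.X (S.π.onV τ))}
    {σ' : Perm (𝒢.X (S.π.onV τ'))} (h : S.MapsArcs τ τ' σ σ') : S.MapsArcs τ' τ σ' σ := by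
  intro c ho ht
  obtain ⟨c', h1, h2, h3, h4⟩ := h (S.graph.rev c) (by rwa [S.graph.o_rev])
    (by rwa [S.graph.t_rev])
  refine ⟨S.graph.rev c', ?_, ?_, ?_, ?_⟩
  · rwa [S.graph.o_rev]
  · rwa [S.graph.t_rev]
  · rwa [S.graph.t_rev, ← S.graph.o_rev c'] at h4
  · rwa [S.graph.o_rev, ← S.graph.t_rev c'] at h3

/-- Both vertex permutations are induced by the single arc relabelling `k⁻¹ h k`, so they move the
two ends of each arc consistently. -/
theorem mapsArcs_of_arc {α : S.tree.A} {p p' : 𝒢.base.V} (hp : S.π.onV (S.tree.t α) = p)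
    (hp' : S.π.onV (S.tree.o α) = p') {k h : Perm (𝒢.Y (𝒢.base.edge (S.π.onA α)))}
    {Ψ : 𝒢.Y (𝒢.base.edge (S.π.onA α)) → 𝒢.X p} {Ψ' : 𝒢.Y (𝒢.base.edge (S.π.onA α)) → 𝒢.X p'}
    (hc : ∀ c, S.bunA c = α → ∀ y, S.pA c = ⟨𝒢.base.edge (S.π.onA α), y⟩ →
      S.pV (S.graph.t c) = ⟨p, Ψ (k y)⟩ ∧ S.pV (S.graph.o c) = ⟨p', Ψ' (k y)⟩)
    {σ : Perm (𝒢.X p)} {σ' : Perm (𝒢.X p')} (hσ : ∀ y, σ (Ψ y) = Ψ (h y))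
    (hσ' : ∀ y, σ' (Ψ' y) = Ψ' (h y)) :
    S.MapsArcs (S.tree.t α) (S.tree.o α) (hp ▸ σ) (hp' ▸ σ') := by
  subst hp hp'
  refine MapsArcs.symm fun c ho ht => ?_
  have hcα : S.bunA c = α := S.tree_arc_ext ho ht
  obtain ⟨y, hy⟩ := S.exists_pA_eq hcα
  obtain ⟨c', hc', hy'⟩ := S.exists_arc_of_color α (k⁻¹ (h (k y)))
  obtain ⟨h1, h2⟩ := hc c hcα y hy
  obtain ⟨h3, h4⟩ := hc c' hc' _ hy'
  rw [perm_apply_inv] at h3 h4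
  refine ⟨c', congrArg S.tree.o hc', congrArg S.tree.t hc', fun ξ hξ => ?_, fun ξ hξ => ?_⟩
  · have h5 := eq_of_heq (Sigma.mk.inj (hξ.symm.trans h2)).2
    rw [h4, h5, hσ']
  · have h5 := eq_of_heq (Sigma.mk.inj (hξ.symm.trans h1)).2
    rw [h3, h5, hσ]

/-- A locally extendable permutation of a bundle extends to a neighbouring bundle, if extendability
has become stable. -/
theorem exists_neighbour_extension {N : ℕ}
    (hN : ∀ a h, 𝒢.IsExtendable N a h → 𝒢.IsExtendable (N + 1) a h) (α : S.tree.A)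
    {p p' : 𝒢.base.V} (hp : S.π.onV (S.tree.t α) = p)
    (hp' : S.π.onV (S.tree.o α) = p') {σ : Perm (𝒢.X p)} (hσ : 𝒢.IsLocallyExtendable N p σ) :
    ∃ σ' ∈ 𝒢.G p', 𝒢.IsLocallyExtendable N p' σ' ∧
      S.MapsArcs (S.tree.t α) (S.tree.o α) (hp ▸ σ) (hp' ▸ σ') ∧
      S.MapsArcs (S.tree.t α) (S.tree.o α) (hp ▸ σ⁻¹) (hp' ▸ σ'⁻¹) := by
  obtain rfl : 𝒢.base.t (S.π.onA α) = p := (S.π.map_t α).symm.trans hp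
  obtain rfl : 𝒢.base.o (S.π.onA α) = p' := (S.π.map_o α).symm.trans hp'
  obtain ⟨k, γ, hγ, δ, hδ, hc⟩ := S.exists_bundle_maps α
  obtain ⟨h, h1, h2⟩ := hσ (S.π.onA α) rfl γ hγ
  -- Stability restores the level spent in crossing the edge, so `g` has the same depth `N` as `σ`.
  obtain ⟨g, hg, h3, h4⟩ := hN _ _ h2
  have h5 : ∀ y, (δ * g * δ⁻¹) (δ (𝒢.Φop _ y)) = δ (𝒢.Φop _ (h y)) := fun y => by
    simp only [Perm.mul_apply, perm_inv_apply, h3]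
  refine ⟨δ * g * δ⁻¹, mul_mem (mul_mem hδ hg) (inv_mem hδ), ?_,
    S.mapsArcs_of_arc hp hp' (Ψ := fun y => γ (𝒢.Φ _ y)) (Ψ' := fun y => δ (𝒢.Φop _ y)) hc h1 h5,
    S.mapsArcs_of_arc hp hp' (Ψ := fun y => γ (𝒢.Φ _ y)) (Ψ' := fun y => δ (𝒢.Φop _ y)) hc
      (h := h⁻¹) (fun y => ?_) (fun y => ?_)⟩
  · have := GraphOfGroupActions.IsLocallyExtendable.conj (n := N) h4 (inv_mem hδ)
    rwa [inv_inv] at this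
  · rw [Perm.inv_eq_iff_eq]
    have := h1 (h⁻¹ y)
    rw [perm_apply_inv] at this
    exact this.symm
  · rw [Perm.inv_eq_iff_eq]
    have := h5 (h⁻¹ y)
    rw [perm_apply_inv] at this
    exact this.symm

/-- A family of permutations of the colour sets gives a permutation of the vertices. -/
theorem exists_perm_of_family (σ : ∀ τ, Perm (𝒢.X (S.π.onV τ))) :
    ∃ f : Perm S.graph.V, (∀ q, S.bunV (f q) = S.bunV q) ∧ (∀ q, S.bunV (f.symm q) = S.bunV q) ∧
      (∀ τ, S.ActsAs f τ (S.π.onV τ) (σ τ)) ∧ ∀ τ, S.ActsAs f.symm τ (S.π.onV τ) (σ τ)⁻¹ := by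
  have key : ∀ s : ∀ τ, Perm (𝒢.X (S.π.onV τ)), ∃ F : S.graph.V → S.graph.V,
      (∀ q, S.bunV (F q) = S.bunV q) ∧ ∀ τ, S.ActsAs F τ (S.π.onV τ) (s τ) := by
    intro s
    have : ∀ q, ∃ r, S.bunV r = S.bunV q ∧
        ∀ ξ, S.pV q = ⟨S.π.onV (S.bunV q), ξ⟩ → S.pV r = ⟨S.π.onV (S.bunV q), s _ ξ⟩ := by
      intro q
      obtain ⟨ξ, hξ⟩ := S.exists_pV_eq (q := q) rfl rfl
      obtain ⟨r, hr, hr'⟩ := S.exists_of_color (τ := S.bunV q) rfl (s _ ξ)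
      refine ⟨r, hr, fun ζ hζ => ?_⟩
      rw [hr', ← eq_of_heq (Sigma.mk.inj (hζ.symm.trans hξ)).2]
    choose F hF hF' using this
    refine ⟨F, hF, ?_⟩
    rintro _ q rfl
    exact hF' q
  obtain ⟨F, hF, hF'⟩ := key σ
  obtain ⟨F₂, hF₂, hF₂'⟩ := key fun τ => (σ τ)⁻¹
  refine ⟨⟨F, F₂, fun q => ?_, fun q => ?_⟩, hF, hF₂, hF', hF₂'⟩
  · refine S.eq_of_pV_eq ((hF₂ _).trans (hF q)) ?_
    obtain ⟨ξ, hξ⟩ := S.exists_pV_eq (q := q) rfl rfl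
    rw [hF₂' (S.bunV q) _ (hF q) _ (hF' _ q rfl ξ hξ), hξ, perm_inv_apply]
  · refine S.eq_of_pV_eq ((hF _).trans (hF₂ q)) ?_
    obtain ⟨ξ, hξ⟩ := S.exists_pV_eq (q := q) rfl rfl
    rw [hF' (S.bunV q) _ (hF₂ q) _ (hF₂' _ q rfl ξ hξ), hξ, perm_apply_inv]

theorem treePerm_eq_self_of_forall {g : S.scAut} {τ : S.tree.V}
    (h : ∀ q, S.bunV q = τ → S.bunV (g.1.1 q) = τ) : S.treePerm g τ = τ := by
  obtain ⟨q⟩ := τ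
  exact h q rfl

theorem adj_bunV (c : S.graph.A) :
    S.tree.toSimple.Adj (S.bunV (S.graph.o c)) (S.bunV (S.graph.t c)) :=
  S.tree_adj (S.bunA c)

/-- An element of the universal group that fixes a sufficiently large ball around a vertex `τ` of
the tree agrees on the bundle `τ` with an element that acts trivially on the tree. -/
theorem exists_trivial_on_tree {N : ℕ}
    (hN : ∀ a h, 𝒢.IsExtendable N a h → 𝒢.IsExtendable (N + 1) a h) {g : S.scAut}
    (hg : g ∈ S.universalGroup) {τ : S.tree.V}
    (hfix : ∀ ρ, S.tree.toSimple.dist ρ τ ≤ N + 1 → S.treePerm g ρ = ρ) :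
    ∃ g' ∈ S.universalGroup, (∀ ρ, S.treePerm g' ρ = ρ) ∧
      ∀ q, S.bunV q = τ → g'.1.1 q = g.1.1 q := by
  obtain ⟨σ₀, hσ₀, hL⟩ := hg τ
  have hσ₀' := S.isLocallyExtendable_of_fixes hg N rfl hL hfix
  obtain ⟨s, hsτ, hs⟩ := S.isTree.2.exists_coherent_choice
    (X := fun ρ => {σ : Perm (𝒢.X (S.π.onV ρ)) // σ ∈ 𝒢.G _ ∧ 𝒢.IsLocallyExtendable N _ σ})
    (fun ρ ρ' σ σ' => S.MapsArcs ρ ρ' σ.1 σ'.1 ∧ S.MapsArcs ρ ρ' σ.1⁻¹ σ'.1⁻¹)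
    (fun _ _ _ _ h => ⟨h.1.symm, h.2.symm⟩)
    (by
      rintro _ _ ⟨-, α, rfl, rfl⟩ σ
      -- Adjacency supplies an arc leaving the current vertex, whereas extension runs from terminus
      -- to origin.
      obtain ⟨α', rfl⟩ : ∃ α', α = S.tree.rev α' := ⟨S.tree.rev α, (S.tree.rev_rev α).symm⟩
      have ho := S.tree.o_rev α'
      have ht := S.tree.t_rev α'
      revert σ
      rw [ho, ht]
      intro σ
      obtain ⟨σ', h1, h2, h3⟩ := S.exists_neighbour_extension hN α' rfl rfl σ.2.2
      exact ⟨⟨σ', h1, h2⟩, h3⟩)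
    τ ⟨σ₀, hσ₀, hσ₀'⟩
  obtain ⟨f, hf, hf', hfs, hfs'⟩ := S.exists_perm_of_family fun ρ => (s ρ).1
  have arcs : ∀ (σ : ∀ ρ, Perm (𝒢.X (S.π.onV ρ))) (F : S.graph.V → S.graph.V),
      (∀ ρ ρ', S.tree.toSimple.Adj ρ ρ' → S.MapsArcs ρ ρ' (σ ρ) (σ ρ')) →
      (∀ q, S.bunV (F q) = S.bunV q) → (∀ ρ, S.ActsAs F ρ (S.π.onV ρ) (σ ρ)) →
      ∀ c, ∃ c', S.graph.o c' = F (S.graph.o c) ∧ S.graph.t c' = F (S.graph.t c) ∧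
        S.π.onA (S.bunA c') = S.π.onA (S.bunA c) := by
    intro σ F h1 h2 h3 c
    obtain ⟨c', ho, ht, ho', ht'⟩ := h1 _ _ (S.adj_bunV c) c rfl rfl
    obtain ⟨ξ, hξ⟩ := S.exists_pV_eq (q := S.graph.o c) rfl rfl
    obtain ⟨ζ, hζ⟩ := S.exists_pV_eq (q := S.graph.t c) rfl rfl
    refine ⟨c', S.eq_of_pV_eq (ho.trans (h2 _).symm) ?_, S.eq_of_pV_eq (ht.trans (h2 _).symm) ?_,
      congrArg S.π.onA (S.tree_arc_ext ho ht)⟩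
    · rw [ho' ξ hξ, h3 _ _ rfl ξ hξ]
    · rw [ht' ζ hζ, h3 _ _ rfl ζ hζ]
  obtain ⟨g', hg', rfl⟩ := S.exists_mem_universalGroup f
    (arcs _ f (fun ρ ρ' h => (hs ρ ρ' h).1) hf hfs)
    (fun c => by
      obtain ⟨c', h1, h2, -⟩ := arcs _ f.symm (fun ρ ρ' h => (hs ρ ρ' h).2) hf' hfs' c
      exact ⟨c', h1, h2⟩)
    (fun q r => by rw [hf, hf]) (fun q => by rw [hf]) fun ρ => ⟨_, (s ρ).2.1, hfs ρ⟩
  refine ⟨g', hg', fun ρ => S.treePerm_eq_self_of_forall fun q hq => (hf q).trans hq, ?_⟩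
  intro q hq
  have hgq : S.bunV (g.1.1 q) = τ :=
    (S.bunV_eq_of_treePerm_eq (hfix τ (by simp)) q).2 hq
  refine S.eq_of_pV_eq ((hf q).trans (hq.trans hgq.symm)) ?_
  obtain ⟨ξ, hξ⟩ := S.exists_pV_eq hq rfl
  rw [hfs τ q hq ξ hξ, hL q hq ξ hξ, hsτ]

theorem dist_treePerm (g : S.scAut) (ρ τ : S.tree.V) :
    S.tree.toSimple.dist (S.treePerm g ρ) (S.treePerm g τ) = S.tree.toSimple.dist ρ τ :=
  dist_iso_apply _ (S.treeHom g) ρ τ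

/-- An element of the universal group that fixes a bundle pointwise can be replaced by the identity
on the other side of an edge of the tree. -/
theorem exists_trivial_on_branch {g : S.scAut} (hg : g ∈ S.universalGroup) {τ τ' : S.tree.V}
    (hadj : S.tree.toSimple.Adj τ τ') (hτ : ∀ q, S.bunV q = τ → g.1.1 q = q)
    (hτ' : S.treePerm g τ' = τ') :
    ∃ g' ∈ S.universalGroup,
      (∀ ρ, S.tree.toSimple.dist ρ τ ≤ S.tree.toSimple.dist ρ τ' →
        S.treePerm g' ρ = S.treePerm g ρ) ∧
      ∀ ρ, ¬ S.tree.toSimple.dist ρ τ ≤ S.tree.toSimple.dist ρ τ' → S.treePerm g' ρ = ρ := by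
  classical
  let P : S.tree.V → Prop := fun ρ => S.tree.toSimple.dist ρ τ ≤ S.tree.toSimple.dist ρ τ'
  have hgτ : S.treePerm g τ = τ :=
    S.treePerm_eq_self_of_forall fun q hq => by rw [hτ q hq, hq]
  have hP : ∀ ρ, P (S.treePerm g ρ) ↔ P ρ := fun ρ => by
    have h1 := S.dist_treePerm g ρ τ
    have h2 := S.dist_treePerm g ρ τ'
    rw [hgτ] at h1
    rw [hτ'] at h2
    simp only [P, h1, h2]
  have hP1 : ∀ q, P (S.bunV (g.1.1 q)) ↔ P (S.bunV q) := fun q => hP (S.bunV q)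
  have hP2 : ∀ q, P (S.bunV (g.1.1.symm q)) ↔ P (S.bunV q) := fun q => by
    rw [← hP1, Equiv.apply_symm_apply]
  let f : Perm S.graph.V :=
    { toFun := fun q => if P (S.bunV q) then g.1.1 q else q
      invFun := fun q => if P (S.bunV q) then g.1.1.symm q else q
      left_inv := fun q => by
        by_cases h : P (S.bunV q)
        · simp [h, hP1]
        · simp [h]
      right_inv := fun q => by
        by_cases h : P (S.bunV q)
        · simp [h, hP2]
        · simp [h] }
  have hf1 : ∀ q, P (S.bunV q) → f q = g.1.1 q := fun q h => if_pos h
  have hf2 : ∀ q, ¬ P (S.bunV q) → f q = q := fun q h => if_neg h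
  have hfP : ∀ q, P (S.bunV (f q)) ↔ P (S.bunV q) := fun q => by
    by_cases h : P (S.bunV q)
    · rw [hf1 q h, hP1]
    · rw [hf2 q h]
  -- An arc crossing between the branches has its end on the near side in the bundle `τ`, which is
  -- fixed pointwise, so the cut map fixes both of its ends.
  have hmix : ∀ ρ ρ', S.tree.toSimple.Adj ρ ρ' → P ρ → ¬ P ρ' → ρ = τ := fun ρ ρ' h h1 h2 =>
    (eq_of_adj_of_dist_le S.isTree.2 hadj h h1 (le_of_not_ge h2)).1
  have arcs : ∀ k : S.scAut, (∀ q, S.bunV q = τ → k.1.1 q = q) →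
      ∀ c, ∃ c', S.graph.o c' =
          (if P (S.bunV (S.graph.o c)) then k.1.1 (S.graph.o c) else S.graph.o c) ∧
        S.graph.t c' = (if P (S.bunV (S.graph.t c)) then k.1.1 (S.graph.t c) else S.graph.t c) ∧
        S.π.onA (S.bunA c') = S.π.onA (S.bunA c) := by
    intro k hk c
    by_cases h1 : P (S.bunV (S.graph.o c)) <;> by_cases h2 : P (S.bunV (S.graph.t c))
    · exact ⟨k.1.2 c, by rw [if_pos h1, (k.2.1 c).1], by rw [if_pos h2, (k.2.1 c).2.1],
        k.2.2.2.2 c⟩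
    · refine ⟨c, ?_, by rw [if_neg h2], rfl⟩
      rw [if_pos h1, hk _ (hmix _ _ (S.adj_bunV c) h1 h2)]
    · refine ⟨c, by rw [if_neg h1], ?_, rfl⟩
      rw [if_pos h2, hk _ (hmix _ _ (S.adj_bunV c).symm h2 h1)]
    · exact ⟨c, by rw [if_neg h1], by rw [if_neg h2], rfl⟩
  obtain ⟨g', hg', hgf⟩ := S.exists_mem_universalGroup f (arcs g hτ)
    (fun c => by
      obtain ⟨c', h1, h2, -⟩ := arcs g⁻¹ (fun q hq => by
        have h := hτ q hq
        exact (congrArg (g⁻¹).1.1 h).symm.trans (perm_inv_apply g.1.1 q)) c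
      exact ⟨c', h1, h2⟩)
    (fun q r => by
      by_cases hq : P (S.bunV q) <;> by_cases hr : P (S.bunV r)
      · rw [hf1 q hq, hf1 r hr, ← S.treePerm_bunV, ← S.treePerm_bunV, (S.treePerm g).apply_eq_iff_eq]
      · refine iff_of_false (fun h => ?_) (fun h => hr (h ▸ hq))
        exact hr ((hfP r).1 (h ▸ (hfP q).2 hq))
      · refine iff_of_false (fun h => ?_) (fun h => hq (h ▸ hr))
        exact hq ((hfP q).1 (h ▸ (hfP r).2 hr))
      · rw [hf2 q hq, hf2 r hr])
    (fun q => by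
      by_cases hq : P (S.bunV q)
      · rw [hf1 q hq]
        exact g.2.2.2.1 q
      · rw [hf2 q hq])
    (fun ρ => by
      by_cases hρ : P ρ
      · obtain ⟨σ, hσ, hL⟩ := hg ρ
        exact ⟨σ, hσ, fun q hq ξ hξ => by rw [hf1 q (hq ▸ hρ)]; exact hL q hq ξ hξ⟩
      · exact ⟨1, one_mem _, fun q hq ξ hξ => by rw [hf2 q (hq ▸ hρ)]; exact hξ⟩)
  refine ⟨g', hg', ?_, ?_⟩
  · rintro ⟨q⟩ hρ
    have := congrArg S.bunV (hf1 q hρ)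
    rwa [← hgf] at this
  · rintro ⟨q⟩ hρ
    have := congrArg S.bunV (hf2 q hρ)
    rwa [← hgf] at this

/-- An element of the tree group that fixes a sufficiently large ball around an edge can be
replaced by the identity on one side of the edge. -/
theorem exists_mem_ballFixator {N : ℕ}
    (hN : ∀ a h, 𝒢.IsExtendable N a h → 𝒢.IsExtendable (N + 1) a h) {τ τ' : S.tree.V}
    (hadj : S.tree.toSimple.Adj τ τ') {g : S.tree.toSimple ≃g S.tree.toSimple}
    (hg : g ∈ ballFixator S.tree.toSimple S.treeGroup (N + 2) {τ, τ'}) :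
    ∃ g' ∈ ballFixator S.tree.toSimple S.treeGroup (N + 2) {τ, τ'},
      (∀ ρ, S.tree.toSimple.dist ρ τ ≤ S.tree.toSimple.dist ρ τ' → g' ρ = g ρ) ∧
      ∀ ρ, ¬ S.tree.toSimple.dist ρ τ ≤ S.tree.toSimple.dist ρ τ' → g' ρ = ρ := by
  obtain ⟨⟨a, ha, rfl⟩, hfix⟩ := hg
  rw [SetLike.mem_coe] at ha
  have hfix' : ∀ ρ ∈ ballAround S.tree.toSimple {τ, τ'} (N + 1), S.treePerm a ρ = ρ :=
    (mem_fixingSubgroup_iff _).1 hfix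
  obtain ⟨k, hk, hk1, hk2⟩ := S.exists_trivial_on_tree hN ha (τ := τ)
    fun ρ hρ => hfix' ρ ⟨τ, by simp, hρ⟩
  have hkinv : S.treePerm k⁻¹ = 1 := by
    have : S.treePerm k = 1 := Equiv.ext hk1
    have h := S.treePerm_mul k⁻¹ k
    rw [inv_mul_cancel, S.treePerm_one, this, mul_one] at h
    exact h.symm
  have hka : ∀ ρ, S.treePerm (k⁻¹ * a) ρ = S.treePerm a ρ := fun ρ => by
    rw [S.treePerm_mul, hkinv, one_mul]
  -- The element `k⁻¹ * a` acts on the tree like `a` but fixes the bundle `τ` pointwise, so it can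
  -- be cut.
  obtain ⟨b, hb, hb1, hb2⟩ := S.exists_trivial_on_branch (mul_mem (inv_mem hk) ha) hadj
    (fun q hq => by
      change (k.1.1)⁻¹ (a.1.1 q) = q
      rw [← hk2 q hq, perm_inv_apply])
    ((hka τ').trans (hfix' τ' ⟨τ', by simp, by simp⟩))
  refine ⟨S.treeHom b, ⟨⟨b, hb, rfl⟩, (mem_fixingSubgroup_iff _).2 fun ρ hρ => ?_⟩,
    fun ρ hρ => (hb1 ρ hρ).trans (hka ρ), hb2⟩
  by_cases h : S.tree.toSimple.dist ρ τ ≤ S.tree.toSimple.dist ρ τ'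
  · exact (hb1 ρ h).trans ((hka ρ).trans (hfix' ρ hρ))
  · exact hb2 ρ h

end Scaffolding

/-! ### Combining the two branches at an edge. -/

theorem mem_branchAt_pair {V : Type u} {T : SimpleGraph V} {p q s : V} :
    s ∈ branchAt T {p, q} p ↔ T.dist s p ≤ T.dist s q := by
  simp [branchAt]

theorem mem_branchAt_pair_right {V : Type u} {T : SimpleGraph V} {p q s : V} :
    s ∈ branchAt T {p, q} q ↔ T.dist s q ≤ T.dist s p := by
  simp [branchAt]

theorem branchHom_injective {V : Type u} {T : SimpleGraph V} (G : Subgroup (T ≃g T)) (k : ℕ)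
    (p q : V) : Function.Injective (branchHom G k {p, q}) := by
  intro g g' h
  refine Subtype.ext (RelIso.ext fun s => ?_)
  have key : ∀ r : ({p, q} : Set V), s ∈ branchAt T {p, q} r → g.1 s = g'.1 s := fun r hr =>
    congrArg Subtype.val
      (DFunLike.congr_fun (congrArg Subtype.val (congrFun h r)) (⟨s, hr⟩ : branchAt T {p, q} r))
  rcases le_total (T.dist s p) (T.dist s q) with hs | hs
  · exact key ⟨p, by simp⟩ (mem_branchAt_pair.2 hs)
  · exact key ⟨q, by simp⟩ (mem_branchAt_pair_right.2 hs)

/-- The map to the product over both branches at an edge is surjective if all elements can be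
replaced by the identity on either branch. -/
theorem branchHom_surjective {V : Type u} {T : SimpleGraph V} (hT : T.IsTree)
    (G : Subgroup (T ≃g T)) (k : ℕ)
    (hG : ∀ p q, T.Adj p q → ∀ g ∈ ballFixator T G k {p, q}, ∃ g' ∈ ballFixator T G k {p, q},
      (∀ s, T.dist s p ≤ T.dist s q → g' s = g s) ∧ ∀ s, ¬ T.dist s p ≤ T.dist s q → g' s = s)
    {p q : V} (hpq : T.Adj p q) : Function.Surjective (branchHom G k {p, q}) := by
  intro F
  obtain ⟨a, ha⟩ := (F ⟨p, by simp⟩).2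
  obtain ⟨b, hb⟩ := (F ⟨q, by simp⟩).2
  obtain ⟨a', ha', ha1, ha2⟩ := hG p q hpq a.1 a.2
  obtain ⟨b', hb', hb1, hb2⟩ := hG q p hpq.symm b.1 (by rw [Set.pair_comm]; exact b.2)
  rw [Set.pair_comm] at hb'
  -- Ties do not occur in a tree, so the branches are disjoint and each factor is the identity on
  -- the other's branch.
  have hne : ∀ s, T.dist s p ≠ T.dist s q := fun s => hT.dist_ne_of_adj s hpq
  refine ⟨⟨a' * b', mul_mem ha' hb'⟩, funext ?_⟩
  rintro ⟨r, hr⟩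
  refine Subtype.ext (Equiv.ext ?_)
  rintro ⟨s, hs⟩
  rcases hr with rfl | rfl
  · refine Subtype.ext (Eq.trans ?_ (congrArg Subtype.val (DFunLike.congr_fun ha ⟨s, hs⟩)))
    have hs' := mem_branchAt_pair.1 hs
    change a' (b' s) = a.1 s
    rw [hb2 s fun h => hne s (le_antisymm hs' h), ha1 s hs']
  · refine Subtype.ext (Eq.trans ?_ (congrArg Subtype.val (DFunLike.congr_fun hb ⟨s, hs⟩)))
    have hbs := (mem_branchAt_iff b.2 (by simp) s).2 hs
    have hs' := mem_branchAt_pair_right.1 hs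
    change a' (b' s) = b.1 s
    rw [hb1 s hs', ha2 _ fun h => hne _ (le_antisymm h (mem_branchAt_pair_right.1 hbs))]

theorem mainTheorem9 (𝒢 : GraphOfGroupActions.{u, v, w, x})
    (hV : Finite 𝒢.base.V) (hA : Finite 𝒢.base.A)
    (hclosed : ∀ p, IsPermClosed (𝒢.G p))
    (hsubdegree : ∀ p, IsSubdegreeFinite (𝒢.G p))
    (hY : ∀ a, Finite (𝒢.Y (𝒢.base.edge a))) :
    ∃ k : ℕ, 1 ≤ k ∧ ∀ S : Scaffolding.{u, v, w, x, y, z} 𝒢,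
      HasPropertyIP S.tree.toSimple S.treeGroup k := by
  obtain ⟨N, hN⟩ := 𝒢.exists_isExtendable_stable hA hY
  -- The fixed ball has radius `k - 1`, which must be the `N + 1` needed for depth `N`. Here `N` is
  -- obtained before any scaffolding is chosen.
  exact ⟨N + 2, by omega, fun S τ τ' hadj => ⟨branchHom_injective _ _ _ _,
    branchHom_surjective S.isTree.2 _ _ (fun p q h g hg => S.exists_mem_ballFixator hN h hg) hadj⟩⟩
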